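/- Let $\lambda=(\lambda_n)_n$ be a frequency, i.e. a strictly increasing sequence of non-negative real numbers tending to $\infty$. A $\lambda$-Dirichlet series is a formal series $D=\sum a_n e^{-\lambda_n s}$ with $a_n\in\mathbb C$; $\sigma_c(D)$ and $\sigma_a(D)$ denote its abscissas of convergence and of absolute convergence, and $L(\lambda):=\sup_D(\sigma_a(D)-\sigma_c(D))$ (the supremum over all $D$ for which the difference is defined). Let $\mathcal D_\infty(\lambda)$ be the set of all $\lambda$-Dirichlet series that converge on $[\mathrm{Re}>0]$ and define a bounded function there, and let $\mathcal D_\infty^{ext}(\lambda)$ be the set of all somewhere convergent $\lambda$-Dirichlet series whose limit function has a bounded holomorphic extension to $[\mathrm{Re}>0]$. A $\lambda$-Dirichlet group is a pair $(G,\beta)$ of a (Hausdorff) compact abelian group $G$ and a continuous homomorphism $\beta:\mathbb R\to G$ with dense range such that for every $n$ there is a (necessarily unique) continuous character $h_{\lambda_n}$ of $G$ with $h_{\lambda_n}(\beta(t))=e^{-i\lambda_n t}$ for all $t\in\mathbb R$. $G$ carries its normalized Haar measure, and $H_\infty^\lambda(G)$ is the space of all $f\in L_\infty(G)$ such that $\widehat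 f(\gamma)\neq 0$, $\gamma\in\widehat G$, implies $\gamma=h_{\lambda_n}$ for some $n$. Let $\mathcal H_\infty(\lambda)$ be the set of all $\lambda$-Dirichlet series $\sum \widehat g(h_{\lambda_n})e^{-\lambda_n s}$ with $g\in H_\infty^\lambda(G_0)$ for some $\lambda$-Dirichlet group $(G_0,\beta_0)$. **Theorem.** Assume that $L(\lambda)<\infty$ and $\mathcal D^{ext}_\infty(\lambda)=\mathcal D_\infty(\lambda)$, and let $D=\sum a_ne^{-\lambda_n s}\in\mathcal H_\infty(\lambda)$. Then for every $\lambda$-Dirichlet group $(G,\beta)$ and almost every $\omega\in G$ the vertical limit $D^\omega(s)=\sum a_n h_{\lambda_n}(\omega)e^{-\lambda_n s}$ converges at every $s\in[\mathrm{Re}>0]$. Moreover, if $f\in H_\infty^\lambda(G)$ corresponds to $D$, i.e. $\widehat f(h_{\lambda_n})=a_n$ for all $n$, then for almost every $\omega\in G$ and all $u>0$, $t\in\mathbb R$, $$(P_u*f_\omega)(t)=D^\omega(u+it),$$ where $f_\omega(t)=f(\omega\beta(t))$, $P_u(t)=\frac1\pi\frac{u}{u^2+t^2}$ and $(P_u*f_\omega)(t)=\int_{\mathbb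 R}P_u(y)f_\omega(t-y)\,dy$ (the integral being absolutely convergent). -/

import Mathlib

open MeasureTheory Filter Topology
open scoped ENNReal Convolution

universe u v

noncomputable section

namespace GeneralDirichlet

/-! ### Frequencies and general Dirichlet series

A formal `lam`-Dirichlet series `∑ aₙ e^{-lamₙ s}` is given by its sequence of coefficients
`a : ℕ → ℂ`. -/

/-- A frequency: a non-negative, strictly increasing sequence of reals tending to `∞`. -/
structure IsFrequency (lam : ℕ → ℝ) : Prop where
  nonneg : ∀ n, 0 ≤ lam n
  strictMono : StrictMono lam
  tendsto : Tendsto lam atTop atTop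

/-- The `n`-th term `aₙ e^{-lamₙ s}`. -/
def term (lam : ℕ → ℝ) (a : ℕ → ℂ) (s : ℂ) (n : ℕ) : ℂ :=
  a n * Complex.exp (-(lam n : ℂ) * s)

/-- The series `∑ aₙ e^{-lamₙ s}` converges at the point `s`, with sum `z` (the partial sums are
taken in the order of the indices). -/
def HasValueAt (lam : ℕ → ℝ) (a : ℕ → ℂ) (s z : ℂ) : Prop :=
  Tendsto (fun N : ℕ => ∑ n ∈ Finset.range N, term lam a s n) atTop (𝓝 z)

/-- The series `∑ aₙ e^{-lamₙ s}` converges at the point `s`. -/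
def ConvergesAt (lam : ℕ → ℝ) (a : ℕ → ℂ) (s : ℂ) : Prop :=
  ∃ z : ℂ, HasValueAt lam a s z

/-- The abscissa of convergence, with values in `[-∞, ∞]`. -/
def sigmaC (lam : ℕ → ℝ) (a : ℕ → ℂ) : EReal :=
  sInf (Real.toEReal '' {σ : ℝ | ∀ s : ℂ, σ < s.re → ConvergesAt lam a s})

/-- The abscissa of absolute convergence, with values in `[-∞, ∞]`. -/
def sigmaA (lam : ℕ → ℝ) (a : ℕ → ℂ) : EReal :=
  sInf (Real.toEReal '' {σ : ℝ | ∀ s : ℂ, σ < s.re → Summable (fun n => ‖term lam a s n‖)})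

/-- `L(lam)`, the maximal width of the strip of convergence and non-absolute convergence. In
`EReal` the undefined differences `⊤ - ⊤` and `⊥ - ⊥` are `⊥`, so series which converge nowhere, or
absolutely everywhere, do not contribute to the supremum. -/
def L (lam : ℕ → ℝ) : EReal :=
  ⨆ a : ℕ → ℂ, sigmaA lam a - sigmaC lam a

/-- `D_∞(lam)`: the series which converge on `[Re > 0]` and define a bounded function there. -/
def DInfty (lam : ℕ → ℝ) : Set (ℕ → ℂ) :=
  {a | ∃ F : ℂ → ℂ, (∀ s : ℂ, 0 < s.re → HasValueAt lam a s (F s)) ∧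
    ∃ C : ℝ, ∀ s : ℂ, 0 < s.re → ‖F s‖ ≤ C}

/-- `D_∞^ext(lam)`: the somewhere convergent series, i.e. series converging on some half plane,
whose limit function has a bounded holomorphic extension to `[Re > 0]`. -/
def DInftyExt (lam : ℕ → ℝ) : Set (ℕ → ℂ) :=
  {a | ∃ F : ℂ → ℂ, DifferentiableOn ℂ F {s : ℂ | 0 < s.re} ∧
    (∃ C : ℝ, ∀ s : ℂ, 0 < s.re → ‖F s‖ ≤ C) ∧
    ∃ σ : ℝ, 0 ≤ σ ∧ ∀ s : ℂ, σ < s.re → HasValueAt lam a s (F s)}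

/-! ### Dirichlet groups -/

section Groups

variable {G : Type u} [CommGroup G] [TopologicalSpace G]

/-- `(G, β)` is a `lam`-Dirichlet group (for a compact abelian group `G` and a continuous
homomorphism `β : ℝ → G`): `β` has dense range, and every character `t ↦ e^{-i lamₙ t}` of `ℝ`
extends through `β` to a continuous character of `G`. -/
structure IsDirichletGroup (lam : ℕ → ℝ) (β : Multiplicative ℝ →ₜ* G) : Prop where
  denseRange : DenseRange β
  exists_char : ∀ n, ∃ γ : PontryaginDual G, ∀ t : ℝ,
    (γ (β (Multiplicative.ofAdd t)) : ℂ) = Complex.exp (-Complex.I * (lam n : ℂ) * (t : ℂ))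

/-- The character `h_{lamₙ}` of `G` with `h_{lamₙ} ∘ β = e^{-i lamₙ ·}`. -/
def IsDirichletGroup.char {lam : ℕ → ℝ} {β : Multiplicative ℝ →ₜ* G}
    (hβ : IsDirichletGroup lam β) (n : ℕ) : PontryaginDual G :=
  (hβ.exists_char n).choose

theorem IsDirichletGroup.char_apply {lam : ℕ → ℝ} {β : Multiplicative ℝ →ₜ* G}
    (hβ : IsDirichletGroup lam β) (n : ℕ) (t : ℝ) :
    (hβ.char n (β (Multiplicative.ofAdd t)) : ℂ)
      = Complex.exp (-Complex.I * (lam n : ℂ) * (t : ℂ)) :=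
  (hβ.exists_char n).choose_spec t

/-- The extension `h_{lamₙ}` is unique. -/
theorem IsDirichletGroup.char_unique {lam : ℕ → ℝ} {β : Multiplicative ℝ →ₜ* G}
    (hβ : IsDirichletGroup lam β) (n : ℕ) (γ : PontryaginDual G)
    (hγ : ∀ t : ℝ, (γ (β (Multiplicative.ofAdd t)) : ℂ)
      = Complex.exp (-Complex.I * (lam n : ℂ) * (t : ℂ))) :
    γ = hβ.char n := by
  apply DFunLike.coe_injective
  refine hβ.denseRange.equalizer (map_continuous γ) (map_continuous (hβ.char n)) ?_
  funext t
  apply Circle.coe_injective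
  exact (hγ t.toAdd).trans (hβ.char_apply n t.toAdd).symm

/-- The coefficients `aₙ h_{lamₙ}(ω)` of the vertical limit `D^ω` of `D = ∑ aₙ e^{-lamₙ s}`. -/
def verticalLimit {lam : ℕ → ℝ} {β : Multiplicative ℝ →ₜ* G}
    (hβ : IsDirichletGroup lam β) (a : ℕ → ℂ) (ω : G) : ℕ → ℂ :=
  fun n => a n * (hβ.char n ω : ℂ)

/-- `f_ω : ℝ → ℂ`, `f_ω(t) = f(ω β(t))`. -/
def orbit (β : Multiplicative ℝ →ₜ* G) (f : G → ℂ) (ω : G) : ℝ → ℂ :=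
  fun t => f (ω * β (Multiplicative.ofAdd t))

variable [IsTopologicalGroup G] [CompactSpace G] [MeasurableSpace G] [BorelSpace G]

variable (G) in
/-- The normalized Haar measure of the compact group `G`. -/
def haar : Measure G := Measure.haarMeasure ⊤

/-- The Fourier coefficient `∫ f(ω) conj(γ(ω)) dω`. -/
def fourierCoeff (f : G → ℂ) (γ : PontryaginDual G) : ℂ :=
  ∫ ω, f ω * (starRingEnd ℂ) (γ ω : ℂ) ∂(haar G)

/-- `f ∈ H_p^lam(G)`: `f` is in `L_p(G)`, and its Fourier transform is supported in
`{h_{lamₙ} | n ∈ ℕ}`. -/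
def MemHardy {lam : ℕ → ℝ} {β : Multiplicative ℝ →ₜ* G}
    (hβ : IsDirichletGroup lam β) (p : ℝ≥0∞) (f : G → ℂ) : Prop :=
  MemLp f p (haar G) ∧
    ∀ γ : PontryaginDual G, fourierCoeff f γ ≠ 0 → γ ∈ Set.range hβ.char

/-- The Bohr map `f ↦ ∑ f̂(h_{lamₙ}) e^{-lamₙ s}`. -/
def bohrMap {lam : ℕ → ℝ} {β : Multiplicative ℝ →ₜ* G}
    (hβ : IsDirichletGroup lam β) (f : G → ℂ) : ℕ → ℂ :=
  fun n => fourierCoeff f (hβ.char n)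

end Groups

/-- The Hardy space `𝓗_p(lam)` of Dirichlet series: the images under the Bohr map of functions in
`H_p^lam(G)`, for some (Hausdorff, compact, abelian) `lam`-Dirichlet group `(G, β)`. -/
def HardyDirichlet (lam : ℕ → ℝ) (p : ℝ≥0∞) : Set (ℕ → ℂ) :=
  {a | ∃ (G : Type u) (_ : CommGroup G) (_ : TopologicalSpace G) (_ : IsTopologicalGroup G)
    (_ : CompactSpace G) (_ : T2Space G) (_ : MeasurableSpace G) (_ : BorelSpace G)
    (β : Multiplicative ℝ →ₜ* G) (hβ : IsDirichletGroup lam β) (f : G → ℂ),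
    MemHardy hβ p f ∧ bohrMap hβ f = a}

/-- The Poisson kernel `P_u(t) = (1/π) u / (u² + t²)` on the real line. -/
def poissonKernel (u : ℝ) : ℝ → ℝ :=
  fun t => 1 / Real.pi * (u / (u ^ 2 + t ^ 2))

/-- The value `(P_u * g)(t) = ∫ P_u(y) g(t - y) dy` is well defined. -/
def PoissonConvExists (u : ℝ) (g : ℝ → ℂ) (t : ℝ) : Prop :=
  ConvolutionExistsAt (poissonKernel u) g t (ContinuousLinearMap.lsmul ℝ ℝ) volume

/-- `(P_u * g)(t) = ∫ P_u(y) g(t - y) dy`. -/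
def poissonConv (u : ℝ) (g : ℝ → ℂ) (t : ℝ) : ℂ :=
  (poissonKernel u ⋆[ContinuousLinearMap.lsmul ℝ ℝ, volume] g) t

end GeneralDirichlet

end

/-! Fix `f` in the Hardy space of `G` with coefficients `aₙ`. Averaging `f` along `β` against a
Gaussian of width `r` multiplies `aₙ` by `exp(-(r λₙ)²/2)`. Since `L(λ) < ∞` forces `∑ exp(-σ λₙ) <
∞` for some `σ` (`exists_summable_exp`), these means are absolutely convergent character series. As
averages of translates they keep the bound of `f` (`HasFourierSeries.norm_gaussSum_le`), and a
sequence of them tends to `f` almost everywhere (`HasFourierSeries.exists_tendsto_ae`). By Fubini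
(`ae_ae_orbit`), on almost every orbit they converge to `f_ω` at almost every time.

For such `ω`, the Poisson integrals of the means are the damped Dirichlet series, so `F(u + it) =
(P_u * f_ω)(t)` is a bounded pointwise limit of holomorphic functions, hence holomorphic. Far to the
right, `F` is the sum of `D^ω`. Thus `D^ω` lies in `D_∞^ext = D_∞`, so it converges on the right
half plane, and the identity theorem gives the sum `F` (`hasValueAt_poissonConv`).

For the first claim, the function defining `D` may live on another group `G₀`. The Gaussian means on
`G` and `G₀` agree along the two copies of `ℝ`, so density carries the bound over to `G`
(`exists_memHardy_of_mem_hardyDirichlet`). Identifying a mean with its series requires the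
completeness of the characters in `L²` (`fourierKernel_eq_bot`), which is proved through compact
convolution operators. -/

noncomputable section

namespace GeneralDirichlet

/-! ### Convergence and holomorphy of general Dirichlet series -/

/-- The pointwise limit of a locally bounded sequence of holomorphic functions is holomorphic. -/
theorem differentiableOn_of_tendsto_of_locally_bounded {U : Set ℂ} (hU : IsOpen U)
    {f : ℕ → ℂ → ℂ} {g : ℂ → ℂ} (hf : ∀ n, DifferentiableOn ℂ (f n) U)
    (hb : ∀ z ∈ U, ∃ M : ℝ, ∀ᶠ w in 𝓝 z, ∀ n, ‖f n w‖ ≤ M)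
    (hlim : ∀ z ∈ U, Tendsto (fun n => f n z) atTop (𝓝 (g z))) :
    DifferentiableOn ℂ g U := by
  intro c hc
  obtain ⟨M, hM⟩ := hb c hc
  obtain ⟨R, hR, hball⟩ := Metric.nhds_basis_closedBall.mem_iff.1
    (inter_mem (hU.mem_nhds hc) hM)
  lift R to NNReal using hR.le
  have hsph : ∀ θ : ℝ, circleMap c R θ ∈ Metric.closedBall c R := fun θ =>
    circleMap_mem_closedBall c hR.le θ
  have hcont : ∀ n, Continuous (fun θ : ℝ => f n (circleMap c R θ)) := fun n =>
    ((hf n).continuousOn.mono fun z hz => (hball hz).1).comp_continuous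
      (continuous_circleMap c R) hsph
  have hgm : AEStronglyMeasurable (fun θ : ℝ => g (circleMap c R θ))
      (volume.restrict (Set.uIoc 0 (2 * Real.pi))) :=
    aestronglyMeasurable_of_tendsto_ae atTop (fun n => (hcont n).aestronglyMeasurable)
      (ae_of_all _ fun θ => hlim _ (hball (hsph θ)).1)
  have hgb : ∀ θ : ℝ, ‖g (circleMap c R θ)‖ ≤ M := fun θ =>
    le_of_tendsto (hlim _ (hball (hsph θ)).1).norm
      (Eventually.of_forall fun n => (hball (hsph θ)).2 n)
  have hgi : CircleIntegrable g c R := by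
    rw [CircleIntegrable, intervalIntegrable_iff]
    have : IsFiniteMeasure (volume.restrict (Set.uIoc 0 (2 * Real.pi))) :=
      ⟨by rw [Measure.restrict_apply_univ, Set.uIoc]; exact measure_Ioc_lt_top⟩
    exact Integrable.mono' (integrable_const M) hgm (ae_of_all _ hgb)
  -- A Cauchy integral is analytic even when its density is merely integrable on the circle. It
  -- remains to pass to the limit in Cauchy's formula for `f n`, so that `g` is its own Cauchy
  -- integral.
  have hps := hasFPowerSeriesOn_cauchy_integral hgi (by exact_mod_cast hR)
  have hEq : ∀ w ∈ Metric.ball c (R : ℝ),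
      (2 * Real.pi * Complex.I : ℂ)⁻¹ • (∮ z in C(c, R), (z - w)⁻¹ • g z) = g w := by
    intro w hw
    have hne : ∀ θ : ℝ, circleMap c R θ - w ≠ 0 := by
      intro θ h
      have h1 : circleMap c R θ ∈ Metric.sphere c R := circleMap_mem_sphere c hR.le θ
      rw [sub_eq_zero.1 h] at h1
      exact (ne_of_lt (Metric.mem_ball.1 hw)) (Metric.mem_sphere.1 h1)
    have hkc : Continuous fun θ : ℝ => deriv (circleMap c R) θ * (circleMap c R θ - w)⁻¹ := by
      simp only [deriv_circleMap]
      exact ((continuous_circleMap 0 R).mul continuous_const).mul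
        (((continuous_circleMap c R).sub continuous_const).inv₀ hne)
    have hlim2 : Tendsto (fun n => ∮ z in C(c, R), (z - w)⁻¹ • f n z) atTop
        (𝓝 (∮ z in C(c, R), (z - w)⁻¹ • g z)) := by
      simp only [circleIntegral, smul_eq_mul, ← mul_assoc]
      refine intervalIntegral.tendsto_integral_filter_of_dominated_convergence
        (fun θ => ‖deriv (circleMap c R) θ * (circleMap c R θ - w)⁻¹‖ * M) ?_ ?_ ?_ ?_
      · exact Eventually.of_forall fun n => (hkc.mul (hcont n)).aestronglyMeasurable
      · refine Eventually.of_forall fun n => ae_of_all _ fun θ _ => ?_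
        rw [norm_mul]
        exact mul_le_mul_of_nonneg_left ((hball (hsph θ)).2 n) (norm_nonneg _)
      · exact (hkc.norm.mul continuous_const).intervalIntegrable _ _
      · exact ae_of_all _ fun θ _ => (hlim _ (hball (hsph θ)).1).const_mul _
    refine tendsto_nhds_unique (hlim2.const_smul _) ?_
    have : ∀ n, (2 * Real.pi * Complex.I : ℂ)⁻¹ • (∮ z in C(c, R), (z - w)⁻¹ • f n z)
        = f n w := fun n =>
      Complex.two_pi_I_inv_smul_circleIntegral_sub_inv_smul_of_differentiable_on_off_countable
        Set.countable_empty hw ((hf n).continuousOn.mono fun z hz => (hball hz).1)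
        fun x hx => (hf n).differentiableAt
          (hU.mem_nhds (hball (Metric.ball_subset_closedBall hx.1)).1)
    simp only [this]
    exact hlim w (hball (Metric.ball_subset_closedBall hw)).1
  have hd : DifferentiableAt ℂ (fun w => (2 * Real.pi * Complex.I : ℂ)⁻¹ •
      (∮ z in C(c, R), (z - w)⁻¹ • g z)) c := hps.analyticAt.differentiableAt
  refine (hd.congr_of_eventuallyEq ?_).differentiableWithinAt
  filter_upwards [Metric.ball_mem_nhds c hR] with w hw using (hEq w hw).symm

/-- The difference is `-w` times the integral of `exp(-w t)` over `[x, y]`; take norms under the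
integral. The bound is itself a difference, so it telescopes when summed over consecutive
frequencies. -/
theorem norm_exp_sub_exp_le {w : ℂ} (hw : 0 < w.re) {x y : ℝ} (hxy : x ≤ y) :
    ‖Complex.exp (-(y : ℂ) * w) - Complex.exp (-(x : ℂ) * w)‖
      ≤ ‖w‖ / w.re * (Real.exp (-x * w.re) - Real.exp (-y * w.re)) := by
  have hw0 : w ≠ 0 := by rintro rfl; simp at hw
  have h1 : ∫ t in x..y, Complex.exp (-w * t)
      = (Complex.exp (-(y : ℂ) * w) - Complex.exp (-(x : ℂ) * w)) / (-w) := by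
    rw [integral_exp_mul_complex (neg_ne_zero.2 hw0)]
    congr 3 <;> ring
  have h2 : ‖∫ t in x..y, Complex.exp (-w * t)‖ ≤ ∫ t in x..y, Real.exp (-w.re * t) := by
    refine (intervalIntegral.norm_integral_le_integral_norm hxy).trans (le_of_eq ?_)
    congr 1 with t
    rw [Complex.norm_exp]
    simp
  have h3 : ∫ t in x..y, Real.exp (-w.re * t)
      = (Real.exp (-x * w.re) - Real.exp (-y * w.re)) / w.re := by
    have := intervalIntegral.integral_comp_mul_left (a := x) (b := y) (fun t => Real.exp t)
      (neg_ne_zero.2 hw.ne')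
    rw [this, integral_exp, smul_eq_mul, ← div_eq_inv_mul, div_neg, ← neg_div, neg_sub]
    congr 3 <;> ring
  rw [h1, h3, norm_div, norm_neg, div_le_iff₀ (norm_pos_iff.2 hw0)] at h2
  calc _ ≤ _ := h2
    _ = _ := by ring

/-- Summation by parts: the partial sums of a Dirichlet series are bounded, and converge, to the
right of a point at which they are bounded. -/
theorem abel_summation {lam : ℕ → ℝ} (hlam : IsFrequency lam) {a : ℕ → ℂ} {s₀ : ℂ} {M : ℝ}
    (hM : ∀ N, ‖∑ n ∈ Finset.range N, term lam a s₀ n‖ ≤ M) {s : ℂ} (hs : s₀.re < s.re) :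
    (∀ N, ‖∑ n ∈ Finset.range N, term lam a s n‖
      ≤ M * (1 + ‖s - s₀‖ / (s.re - s₀.re))) ∧ ConvergesAt lam a s := by
  set w := s - s₀ with hwdef
  have hw : 0 < w.re := by simp [hwdef, hs]
  have hM0 : 0 ≤ M := (norm_nonneg _).trans (hM 0)
  set e : ℕ → ℂ := fun n => Complex.exp (-(lam n : ℂ) * w) with he
  have hen : ∀ n, ‖e n‖ = Real.exp (-lam n * w.re) := fun n => by
    rw [he, Complex.norm_exp]; simp
  set B : ℕ → ℂ := fun N => ∑ n ∈ Finset.range N, term lam a s₀ n with hB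
  have hterm : ∀ n, term lam a s n = e n • term lam a s₀ n := fun n => by
    simp only [term, he, smul_eq_mul, hwdef]
    rw [mul_left_comm, ← Complex.exp_add]
    congr 2; ring
  have hparts : ∀ N, ∑ n ∈ Finset.range (N + 1), term lam a s n
      = e N • B (N + 1) - ∑ i ∈ Finset.range N, (e (i + 1) - e i) • B (i + 1) := fun N => by
    simp only [hterm]
    rw [Finset.sum_range_by_parts]
    rfl
  have hdiff : ∀ i, ‖(e (i + 1) - e i) • B (i + 1)‖ ≤ M * (‖w‖ / w.re) *
      (Real.exp (-lam i * w.re) - Real.exp (-lam (i + 1) * w.re)) := fun i => by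
    rw [norm_smul]
    have := norm_exp_sub_exp_le hw (hlam.strictMono.monotone (Nat.le_succ i))
    calc _ ≤ _ := mul_le_mul this (hM (i + 1)) (norm_nonneg _) ((norm_nonneg _).trans this)
      _ = _ := by ring
  have htel : ∀ N, ∑ i ∈ Finset.range N,
      (Real.exp (-lam i * w.re) - Real.exp (-lam (i + 1) * w.re)) ≤ 1 := fun N => by
    rw [Finset.sum_range_sub']
    have h0 : Real.exp (-lam 0 * w.re) ≤ 1 := by
      rw [Real.exp_le_one_iff]
      nlinarith [hlam.nonneg 0, hw]
    linarith [Real.exp_pos (-lam N * w.re)]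
  have hsumb : ∀ N, ∑ i ∈ Finset.range N, ‖(e (i + 1) - e i) • B (i + 1)‖
      ≤ M * (‖w‖ / w.re) := fun N => by
    refine (Finset.sum_le_sum fun i _ => hdiff i).trans ?_
    rw [← Finset.mul_sum]
    exact mul_le_of_le_one_right (by positivity) (htel N)
  have hre : s.re - s₀.re = w.re := by simp [hwdef]
  constructor
  · rw [hre]
    intro N
    rcases N with _ | N
    · simp only [Finset.range_zero, Finset.sum_empty, norm_zero]
      positivity
    · rw [hparts]
      have h1 : ‖e N • B (N + 1)‖ ≤ M := by
        rw [norm_smul, hen]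
        have : Real.exp (-lam N * w.re) ≤ 1 := by
          rw [Real.exp_le_one_iff]; nlinarith [hlam.nonneg N, hw]
        calc _ ≤ 1 * M := mul_le_mul this (hM _) (norm_nonneg _) zero_le_one
          _ = M := one_mul M
      refine (norm_sub_le _ _).trans ?_
      rw [mul_add, mul_one]
      exact add_le_add h1 ((norm_sum_le _ _).trans (hsumb N))
  -- The boundary term of the summation by parts dies because `lam N → ∞`, and what is left
  -- converges absolutely.
  · have hsummable : Summable fun i => (e (i + 1) - e i) • B (i + 1) :=
      Summable.of_norm (summable_of_sum_range_le (fun _ => norm_nonneg _) hsumb)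
    have he0 : Tendsto (fun N => e N • B (N + 1)) atTop (𝓝 0) := by
      have hexp : Tendsto (fun N => Real.exp (-lam N * w.re) * M) atTop (𝓝 0) := by
        rw [← zero_mul M]
        refine Tendsto.mul_const M (Real.tendsto_exp_atBot.comp ?_)
        have := hlam.tendsto.atTop_mul_const hw
        simpa [Function.comp_def] using tendsto_neg_atTop_atBot.comp this
      refine squeeze_zero_norm (fun N => ?_) hexp
      rw [norm_smul, hen]
      exact mul_le_mul_of_nonneg_left (hM _) (Real.exp_pos _).le
    refine ⟨0 - ∑' i, (e (i + 1) - e i) • B (i + 1), ?_⟩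
    rw [HasValueAt, ← tendsto_add_atTop_iff_nat 1]
    simp only [hparts]
    exact he0.sub hsummable.hasSum.tendsto_sum_nat

/-- If `L(lam) < ∞` then `∑ e^{-σ lamₙ}` converges for some `σ > 0`. -/
theorem exists_summable_exp {lam : ℕ → ℝ} (hlam : IsFrequency lam) (hL : L lam < ⊤) :
    ∃ σ : ℝ, 0 < σ ∧ Summable fun n => Real.exp (-lam n * σ) := by
  -- Alternating signs keep the partial sums at `0` bounded, so `sigmaC ≤ 0`, while absolute
  -- convergence at a real `σ` is exactly the summability sought.
  set a : ℕ → ℂ := fun n => (-1) ^ n with ha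
  have hc : sigmaC lam a ≤ ((0 : ℝ) : EReal) := by
    refine sInf_le ⟨0, fun s hs => ?_, rfl⟩
    have hb : ∀ N, ‖∑ n ∈ Finset.range N, term lam a 0 n‖ ≤ 1 := fun N => by
      simp only [term, mul_zero, Complex.exp_zero, mul_one, ha]
      rw [neg_one_geom_sum]
      split_ifs <;> simp
    exact (abel_summation hlam hb (by simpa using hs)).2
  have hA : sigmaA lam a < ⊤ := by
    by_contra h
    have htop : sigmaA lam a = ⊤ := not_lt_top_iff.1 h
    have h1 : sigmaA lam a - sigmaC lam a ≤ L lam := le_iSup (fun a => sigmaA lam a - sigmaC lam a) a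
    rw [htop, EReal.top_sub (ne_top_of_le_ne_top (EReal.coe_ne_top 0) hc)] at h1
    exact absurd hL (not_lt.2 h1)
  obtain ⟨_, ⟨σ, hσ, rfl⟩, -⟩ := sInf_lt_iff.1 hA
  refine ⟨max σ 0 + 1, by positivity, ?_⟩
  have := hσ ((max σ 0 + 1 : ℝ) : ℂ) (by
    rw [Complex.ofReal_re]; linarith [le_max_left σ 0])
  refine this.congr fun n => ?_
  simp only [term, ha, norm_mul, norm_pow, norm_neg, norm_one, one_pow, one_mul, Complex.norm_exp]
  congr 1
  simp

/-- The limit function of a Dirichlet series which converges on `[Re > 0]` is holomorphic. -/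
theorem differentiableOn_of_hasValueAt {lam : ℕ → ℝ} (hlam : IsFrequency lam) {a : ℕ → ℂ}
    {F : ℂ → ℂ} (hF : ∀ s : ℂ, 0 < s.re → HasValueAt lam a s (F s)) :
    DifferentiableOn ℂ F {s : ℂ | 0 < s.re} := by
  have hopen : IsOpen {s : ℂ | 0 < s.re} := isOpen_lt continuous_const Complex.continuous_re
  refine differentiableOn_of_tendsto_of_locally_bounded hopen
    (f := fun N s => ∑ n ∈ Finset.range N, term lam a s n) (fun N => ?_) ?_ hF
  · refine Differentiable.differentiableOn ?_
    unfold term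
    fun_prop
  · intro z hz
    have hz' : 0 < z.re := hz
    -- Any point strictly to the left of `z` inside the half plane would do: the bound of
    -- `abel_summation` based there is continuous at `z`, hence locally uniform.
    set s₀ : ℂ := ((z.re / 2 : ℝ) : ℂ) with hs₀
    have hs₀re : s₀.re = z.re / 2 := by simp [hs₀]
    obtain ⟨M, hM⟩ := (hF s₀ (by rw [hs₀re]; positivity)).norm.bddAbove_range
    have hM' : ∀ N, ‖∑ n ∈ Finset.range N, term lam a s₀ n‖ ≤ M := fun N => hM ⟨N, rfl⟩
    have hcont : ContinuousAt (fun s : ℂ => M * (1 + ‖s - s₀‖ / (s.re - s₀.re))) z := by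
      have : z.re - s₀.re ≠ 0 := by rw [hs₀re]; linarith
      fun_prop (disch := assumption)
    refine ⟨M * (1 + ‖z - s₀‖ / (z.re - s₀.re)) + 1, ?_⟩
    have h1 : ∀ᶠ s : ℂ in 𝓝 z, s₀.re < s.re :=
      (isOpen_lt continuous_const Complex.continuous_re).mem_nhds (by
        change s₀.re < z.re
        rw [hs₀re]; linarith)
    filter_upwards [h1, hcont.eventually (gt_mem_nhds (lt_add_one _))] with s hs hs2 N
    exact ((abel_summation hlam hM' hs).1 N).trans hs2.le

/-! ### The Poisson kernel and its Fourier transform -/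

theorem poissonKernel_eq_cauchyPDFReal {u : ℝ} (hu : 0 < u) :
    poissonKernel u = ProbabilityTheory.cauchyPDFReal 0 u.toNNReal := by
  funext t
  simp only [poissonKernel, ProbabilityTheory.cauchyPDFReal_def, sub_zero,
    Real.coe_toNNReal u hu.le]
  rw [add_comm (t ^ 2), div_eq_mul_inv u, one_div, mul_assoc]

theorem poissonKernel_nonneg {u : ℝ} (hu : 0 < u) (t : ℝ) : 0 ≤ poissonKernel u t := by
  unfold poissonKernel; positivity

theorem integrable_poissonKernel {u : ℝ} (hu : 0 < u) : Integrable (poissonKernel u) := by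
  rw [poissonKernel_eq_cauchyPDFReal hu]
  exact ProbabilityTheory.integrable_cauchyPDFReal 0

theorem integral_poissonKernel {u : ℝ} (hu : 0 < u) : ∫ t, poissonKernel u t = 1 := by
  rw [poissonKernel_eq_cauchyPDFReal hu]
  exact ProbabilityTheory.integral_cauchyPDFReal_eq_one 0 (Real.toNNReal_pos.2 hu).ne'

/-- The Fourier transform of the Poisson kernel. -/
theorem integral_poissonKernel_mul_exp {u : ℝ} (hu : 0 < u) {x : ℝ} (hx : 0 ≤ x) :
    ∫ y : ℝ, (poissonKernel u y : ℂ) * Complex.exp (Complex.I * x * y)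
      = Complex.exp (-(x : ℂ) * u) := by
  -- The transform is computed in the easy direction, from `exp(-u|t|)` to the kernel, by two
  -- half-line integrals; Fourier inversion then gives the claim.
  set g : ℝ → ℂ := fun t => Complex.exp (-(u * |t| : ℝ)) with hg
  have hpos : ∀ (c : ℂ) (t : ℝ), t ∈ Set.Ioi (0 : ℝ) →
      Complex.exp (c * t) * g t = Complex.exp ((c - u) * t) := fun c t ht => by
    simp only [hg]
    rw [abs_of_pos ht, ← Complex.exp_add]; congr 1; push_cast; ring
  have hneg : ∀ (c : ℂ) (t : ℝ), t ∈ Set.Iic (0 : ℝ) →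
      Complex.exp (c * t) * g t = Complex.exp ((c + u) * t) := fun c t ht => by
    simp only [hg]
    rw [abs_of_nonpos ht, ← Complex.exp_add]; congr 1; push_cast; ring
  have hint : ∀ c : ℂ, c.re = 0 → IntegrableOn (fun t : ℝ => Complex.exp (c * t) * g t) (Set.Ioi 0) ∧
      IntegrableOn (fun t : ℝ => Complex.exp (c * t) * g t) (Set.Iic 0) := fun c hc =>
    ⟨(integrableOn_congr_fun (hpos c) measurableSet_Ioi).2
      (integrableOn_exp_mul_complex_Ioi (by simp [hc, hu]) 0),
    (integrableOn_congr_fun (hneg c) measurableSet_Iic).2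
      (integrableOn_exp_mul_complex_Iic (by simp [hc, hu]) 0)⟩
  have hgint : Integrable g := by
    have := hint 0 rfl
    simp only [zero_mul, Complex.exp_zero, one_mul] at this
    rw [← integrableOn_univ, ← Set.Iic_union_Ioi (a := (0 : ℝ))]
    exact this.2.union this.1
  have hgc : Continuous g := by fun_prop
  have hF : ∀ ξ : ℝ, FourierTransform.fourier g ξ
      = (2 * Real.pi * poissonKernel u (2 * Real.pi * ξ) : ℝ) := by
    intro ξ
    obtain ⟨c, hc⟩ : ∃ c : ℂ, c = -(2 * Real.pi * ξ) * Complex.I := ⟨_, rfl⟩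
    have hcre : c.re = 0 := by simp [hc]
    have h1 : FourierTransform.fourier g ξ = ∫ t : ℝ, Complex.exp (c * t) * g t := by
      rw [Real.fourier_eq']
      congr 1 with t
      rw [smul_eq_mul]
      congr 2
      simp only [hc, RCLike.inner_apply, conj_trivial]
      push_cast; ring
    have h2 : c - u ≠ 0 := fun h => by
      have := congrArg Complex.re h
      simp [hcre] at this
      exact hu.ne' this
    have h3 : c + u ≠ 0 := fun h => by
      have := congrArg Complex.re h
      simp [hcre] at this
      exact hu.ne' this
    have hcc : c ^ 2 = -(2 * Real.pi * ξ) ^ 2 := by rw [hc, mul_pow, Complex.I_sq]; ring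
    have h4 : ((u : ℂ) ^ 2 + (2 * Real.pi * ξ) ^ 2) ≠ 0 := by
      have : (u : ℂ) ^ 2 + (2 * Real.pi * ξ) ^ 2 = -((c - u) * (c + u)) := by
        linear_combination hcc
      rw [this]; exact neg_ne_zero.2 (mul_ne_zero h2 h3)
    rw [h1, ← intervalIntegral.integral_Iic_add_Ioi (hint c hcre).2 (hint c hcre).1,
      setIntegral_congr_fun measurableSet_Ioi (hpos c),
      setIntegral_congr_fun measurableSet_Iic (hneg c),
      integral_exp_mul_complex_Ioi (by simp [hcre, hu]),
      integral_exp_mul_complex_Iic (by simp [hcre, hu])]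
    have key : 1 / (c + u) + -1 / (c - u) = 2 * u / (u ^ 2 + (2 * Real.pi * ξ) ^ 2) := by
      rw [div_add_div _ _ h3 h2, div_eq_div_iff (mul_ne_zero h3 h2) h4]
      linear_combination (-2 * (u : ℂ)) * hcc
    simp only [poissonKernel]
    have hpi : (Real.pi : ℂ) ≠ 0 := Complex.ofReal_ne_zero.2 Real.pi_ne_zero
    push_cast
    simp only [mul_zero, Complex.exp_zero]
    rw [key]
    field_simp
  have hFint : Integrable (FourierTransform.fourier g) := by
    have h1 : Integrable fun ξ : ℝ => 2 * Real.pi * poissonKernel u (2 * Real.pi * ξ) :=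
      ((integrable_poissonKernel hu).comp_mul_left' (by positivity)).const_mul _
    exact h1.ofReal.congr (ae_of_all _ fun ξ => (hF ξ).symm)
  have hinv := congrFun (hgc.fourierInv_fourier_eq hgint hFint) x
  rw [Real.fourierInv_eq'] at hinv
  have hgx : g x = Complex.exp (-(x : ℂ) * u) := by
    simp only [hg]
    rw [abs_of_nonneg hx]; congr 1; push_cast; ring
  rw [← hgx, ← hinv]
  have hsub := Measure.integral_comp_mul_left
    (fun y : ℝ => (poissonKernel u y : ℂ) * Complex.exp (Complex.I * x * y)) (2 * Real.pi)
  have hpi : (2 * Real.pi) ≠ 0 := by positivity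
  have hsub' : ∫ y : ℝ, (poissonKernel u y : ℂ) * Complex.exp (Complex.I * x * y)
      = (2 * Real.pi : ℝ) • ∫ v : ℝ, (poissonKernel u (2 * Real.pi * v) : ℂ) *
        Complex.exp (Complex.I * x * (2 * Real.pi * v : ℝ)) := by
    rw [hsub, abs_of_pos (by positivity), smul_smul, mul_inv_cancel₀ hpi, one_smul]
  rw [hsub', ← integral_smul]
  congr 1 with v
  rw [hF]
  simp only [RCLike.inner_apply, conj_trivial, Complex.real_smul, smul_eq_mul]
  push_cast
  rw [show 2 * (Real.pi : ℂ) * (x * v) * Complex.I = Complex.I * x * (2 * Real.pi * v) by ring]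
  ring

/-! ### Completeness of the characters of a compact abelian group -/

/-- Commuting endomorphisms which leave a nonzero finite-dimensional subspace invariant have a
common eigenvector in this subspace. -/
theorem exists_common_eigenvector {X ι : Type*} [AddCommGroup X] [Module ℂ X]
    (R : ι → Module.End ℂ X) (hR : ∀ i j x, R i (R j x) = R j (R i x))
    (W : Submodule ℂ X) [FiniteDimensional ℂ W] (hW : W ≠ ⊥) (hinv : ∀ i, ∀ x ∈ W, R i x ∈ W) :
    ∃ v ∈ W, v ≠ 0 ∧ ∀ i, ∃ c : ℂ, R i v = c • v := by
  let P : ℕ → Prop := fun d => ∃ M : Submodule ℂ X, M ≤ W ∧ M ≠ ⊥ ∧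
    (∀ i, ∀ x ∈ M, R i x ∈ M) ∧ Module.finrank ℂ M = d
  have hP : ∃ d, P d := ⟨_, W, le_rfl, hW, hinv, rfl⟩
  classical
  obtain ⟨M, hMW, hM0, hMinv, hMd⟩ := Nat.find_spec hP
  have hmin := fun d (h : P d) => Nat.find_min' hP h
  rw [← hMd] at hmin
  have : FiniteDimensional ℂ M := Submodule.finiteDimensional_of_le hMW
  have : Nontrivial M := Submodule.nontrivial_iff_ne_bot.2 hM0
  obtain ⟨v, hvM, hv0⟩ := M.exists_mem_ne_zero_of_ne_bot hM0
  refine ⟨v, hMW hvM, hv0, fun i => ?_⟩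
  obtain ⟨c, hc⟩ := Module.End.exists_eigenvalue ((R i).restrict (hMinv i))
  obtain ⟨w, hw⟩ := hc.exists_hasEigenvector
  have hwc : R i w = c • (w : X) := congrArg Subtype.val hw.apply_eq_smul
  -- `M` is a nonzero invariant subspace of least dimension. The eigenspace of `R i` in it is again
  -- invariant, by commutation, so it is all of `M`, and every nonzero vector of `M` serves for all
  -- `i`.
  let M' : Submodule ℂ X := M ⊓ LinearMap.ker (R i - c • LinearMap.id)
  have hmem : ∀ x, x ∈ M' ↔ x ∈ M ∧ R i x = c • x := fun x => by
    simp [M', sub_eq_zero]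
  have hM'0 : M' ≠ ⊥ := by
    intro h
    have : (w : X) ∈ M' := (hmem _).2 ⟨w.2, hwc⟩
    rw [h, Submodule.mem_bot] at this
    exact hw.2 (Subtype.ext this)
  have hM'inv : ∀ j, ∀ x ∈ M', R j x ∈ M' := fun j x hx => by
    rw [hmem] at hx ⊢
    exact ⟨hMinv j x hx.1, by rw [hR, hx.2, map_smul]⟩
  have heq : M' = M := Submodule.eq_of_le_of_finrank_le inf_le_left
    (hmin _ ⟨M', inf_le_left.trans hMW, hM'0, hM'inv, rfl⟩)
  exact ⟨c, ((hmem v).1 (heq ▸ hvM)).2⟩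

section Groups

variable {G : Type u} [CommGroup G] [TopologicalSpace G]

/-- A nonzero continuous function whose translates are all proportional to it is a multiple of a
character. -/
theorem exists_eq_smul_char [CompactSpace G] (h : C(G, ℂ)) (h0 : h ≠ 0)
    (hh : ∀ z, ∃ c : ℂ, ∀ x, h (x * z) = c * h x) :
    h 1 ≠ 0 ∧ ∃ γ : PontryaginDual G, ∀ x, h x = h 1 * (γ x : ℂ) := by
  have hone : ∀ z x, h (x * z) * h 1 = h z * h x := fun z x => by
    obtain ⟨c, hc⟩ := hh z
    have h1 := hc 1
    rw [one_mul] at h1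
    rw [hc x, h1]; ring
  have h10 : h 1 ≠ 0 := by
    intro h1
    refine h0 (ContinuousMap.ext fun z => ?_)
    obtain ⟨c, hc⟩ := hh z
    simpa [h1] using hc 1
  refine ⟨h10, ?_⟩
  let χ : G →* ℂ :=
    { toFun := fun x => h x / h 1
      map_one' := div_self h10
      map_mul' := fun x y => by
        field_simp
        rw [hone, mul_comm] }
  have hχc : Continuous χ := h.continuous.div_const _
  obtain ⟨M, hM⟩ := isCompact_univ.exists_bound_of_continuousOn (f := χ) hχc.continuousOn
  -- A multiplicative function bounded on the compact group cannot exceed `1` in modulus, as its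
  -- powers would blow up; the same at `x⁻¹` gives equality.
  have hle : ∀ x, ‖χ x‖ ≤ 1 := fun x => by
    by_contra hx
    obtain ⟨n, hn⟩ := pow_unbounded_of_one_lt M (not_le.1 hx)
    have := hM (x ^ n) (Set.mem_univ _)
    rw [map_pow, norm_pow] at this
    linarith
  have hnorm : ∀ x, ‖χ x‖ = 1 := fun x => by
    refine le_antisymm (hle x) ?_
    have h1 : ‖χ x‖ * ‖χ x⁻¹‖ = 1 := by
      rw [← norm_mul, ← map_mul, mul_inv_cancel, map_one, norm_one]
    nlinarith [hle x, hle x⁻¹, norm_nonneg (χ x), norm_nonneg (χ x⁻¹)]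
  let γ : G →ₜ* Circle :=
    { toFun := fun x => ⟨χ x, mem_sphere_zero_iff_norm.2 (hnorm x)⟩
      map_one' := Circle.ext (map_one χ)
      map_mul' := fun x y => Circle.ext (map_mul χ x y)
      continuous_toFun := hχc.subtype_mk _ }
  refine ⟨γ, fun x => ?_⟩
  change h x = h 1 * (h x / h 1)
  field_simp

/-- Translation by `z` on the continuous functions. -/
def translate [IsTopologicalGroup G] (z : G) : C(G, ℂ) →ₗ[ℂ] C(G, ℂ) where
  toFun φ := ⟨fun x => φ (x * z), by fun_prop⟩
  map_add' _ _ := rfl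
  map_smul' _ _ := rfl

theorem translate_apply [IsTopologicalGroup G] (z : G) (φ : C(G, ℂ)) (x : G) : translate z φ x = φ (x * z) := rfl

variable [IsTopologicalGroup G] [CompactSpace G] [MeasurableSpace G] [BorelSpace G]

instance : IsProbabilityMeasure (haar G) := ⟨Measure.haarMeasure_self⟩

instance : (haar G).IsHaarMeasure := inferInstanceAs (Measure.haarMeasure ⊤).IsHaarMeasure

instance : (haar G).Regular := inferInstanceAs (Measure.haarMeasure ⊤).Regular

variable (G) in
/-- The Hilbert space `L_2(G)`. -/
abbrev L2 : Type u := Lp ℂ 2 (haar G)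

/-- The embedding of the continuous functions into `L_2(G)`. -/
abbrev toL2 : C(G, ℂ) →L[ℂ] L2 G := ContinuousMap.toLp 2 (haar G) ℂ

/-- A character as a continuous complex function. -/
def charFn (γ : PontryaginDual G) : C(G, ℂ) :=
  ⟨fun x => (γ x : ℂ), continuous_subtype_val.comp (map_continuous γ)⟩

theorem inner_toL2 (φ : C(G, ℂ)) (g : L2 G) :
    inner ℂ (toL2 φ) g = ∫ x, g x * (starRingEnd ℂ) (φ x) ∂(haar G) := by
  rw [L2.inner_def]
  refine integral_congr_ae ?_
  filter_upwards [ContinuousMap.coeFn_toLp (𝕜 := ℂ) (p := 2) (haar G) φ] with x hx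
  rw [hx, RCLike.inner_apply]

/-- The functions `y ↦ conj k(x y⁻¹)`, as a continuous family in `L_2(G)`. -/
def convKernel (k : C(G, ℂ)) : C(G, L2 G) :=
  ⟨fun x => toL2 ((ContinuousMap.curry
      ⟨fun p : G × G => (starRingEnd ℂ) (k (p.1 * p.2⁻¹)), by fun_prop⟩) x),
    (toL2 (G := G)).continuous.comp (ContinuousMap.continuous _)⟩

theorem inner_convKernel (k : C(G, ℂ)) (x : G) (g : L2 G) :
    inner ℂ (convKernel k x) g = ∫ y, k (x * y⁻¹) * g y ∂(haar G) := by
  rw [convKernel, ContinuousMap.coe_mk, inner_toL2]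
  congr 1 with y
  simp [mul_comm]

/-- Convolution with a continuous function, as an operator from `L_2(G)` to `C(G)`. -/
def conv (k : C(G, ℂ)) : L2 G →L[ℂ] C(G, ℂ) :=
  LinearMap.mkContinuous
    { toFun := fun g => ⟨fun x => inner ℂ (convKernel k x) g, by fun_prop⟩
      map_add' := fun g g' => by ext x; exact inner_add_right (𝕜 := ℂ) (convKernel k x) g g'
      map_smul' := fun c g => by ext x; exact inner_smul_right (𝕜 := ℂ) (convKernel k x) g c }
    ‖convKernel k‖ fun g => by
      rw [ContinuousMap.norm_le _ (by positivity)]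
      intro x
      exact (norm_inner_le_norm _ _).trans
        (mul_le_mul_of_nonneg_right ((convKernel k).norm_coe_le_norm x) (norm_nonneg _))

theorem conv_apply (k : C(G, ℂ)) (g : L2 G) (x : G) :
    conv k g x = ∫ y, k (x * y⁻¹) * g y ∂(haar G) := inner_convKernel k x g

theorem conv_toL2_apply (k φ : C(G, ℂ)) (x : G) :
    conv k (toL2 φ) x = ∫ y, k (x * y⁻¹) * φ y ∂(haar G) := by
  rw [conv_apply]
  refine integral_congr_ae ?_
  filter_upwards [ContinuousMap.coeFn_toLp (𝕜 := ℂ) (p := 2) (haar G) φ] with y hy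
  rw [hy]

/-- By Cauchy–Schwarz and the continuity of `x ↦ convKernel k x` into `L²`, the image of the unit
ball is equibounded and equicontinuous, so Arzelà–Ascoli applies. The isometry `J` only moves the
question to bounded continuous functions. -/
theorem isCompactOperator_conv (k : C(G, ℂ)) : IsCompactOperator (conv k) := by
  let J := ContinuousMap.linearIsometryBoundedOfCompact G ℂ ℂ
  let S : L2 G →L[ℂ] BoundedContinuousFunction G ℂ := J.toContinuousLinearEquiv.toContinuousLinearMap ∘L conv k
  have hS : IsCompactOperator S := by
    refine (isCompactOperator_iff_isCompact_closure_image_closedBall S.toLinearMap one_pos).2 ?_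
    refine BoundedContinuousFunction.arzela_ascoli (Metric.closedBall 0 ‖convKernel k‖)
      (isCompact_closedBall _ _) _ ?_ ?_
    · rintro _ x ⟨g, hg, rfl⟩
      rw [mem_closedBall_zero_iff] at hg ⊢
      calc ‖inner ℂ (convKernel k x) g‖ ≤ ‖convKernel k x‖ * ‖g‖ := norm_inner_le_norm _ _
        _ ≤ ‖convKernel k‖ * 1 := mul_le_mul ((convKernel k).norm_coe_le_norm x) hg
            (norm_nonneg _) (norm_nonneg _)
        _ = _ := mul_one _
    · intro x₀
      rw [Metric.equicontinuousAt_iff_right]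
      intro ε hε
      filter_upwards [(convKernel k).continuous.continuousAt.eventually
        (Metric.ball_mem_nhds (convKernel k x₀) hε)] with x hx
      rintro ⟨_, g, hg, rfl⟩
      rw [mem_closedBall_zero_iff] at hg
      rw [dist_comm] at hx
      change dist (inner ℂ (convKernel k x₀) g) (inner ℂ (convKernel k x) g) < ε
      rw [dist_eq_norm, ← inner_sub_left]
      calc _ ≤ ‖convKernel k x₀ - convKernel k x‖ * ‖g‖ := norm_inner_le_norm _ _
        _ ≤ ‖convKernel k x₀ - convKernel k x‖ * 1 := by gcongr
        _ < ε := by rw [mul_one, ← dist_eq_norm]; exact hx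
  have h : conv k = J.symm.toContinuousLinearEquiv.toContinuousLinearMap ∘L S := by
    ext g x
    simp [S]
  rw [h]
  exact hS.clm_comp (J.symm.toContinuousLinearEquiv.toContinuousLinearMap)

theorem conv_charFn (k : C(G, ℂ)) (γ : PontryaginDual G) :
    ∃ c : ℂ, conv k (toL2 (charFn γ)) = c • charFn γ := by
  refine ⟨∫ y, k y⁻¹ * (γ y : ℂ) ∂(haar G), ContinuousMap.ext fun x => ?_⟩
  rw [conv_toL2_apply, ContinuousMap.smul_apply, smul_eq_mul, ← integral_mul_const,
    ← integral_mul_left_eq_self _ x]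
  congr 1 with y
  simp only [charFn, ContinuousMap.coe_mk, mul_inv_rev, map_mul, Circle.coe_mul]
  rw [mul_comm x (y⁻¹ * x⁻¹), inv_mul_cancel_right]
  ring

/-- By density it suffices to treat continuous functions. For these the order of integration can be
exchanged on a compact group without second countability, and `hk` matches the two kernels. -/
theorem isSymmetric_conv [T2Space G] {k : C(G, ℂ)} (hk : ∀ x, k x⁻¹ = (starRingEnd ℂ) (k x)) :
    (toL2 ∘L conv k : L2 G →L[ℂ] L2 G).toLinearMap.IsSymmetric := by
  have hdense : DenseRange (toL2 : C(G, ℂ) →L[ℂ] L2 G) :=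
    ContinuousMap.toLp_denseRange ℂ (haar G) ℂ (by simp)
  intro g h
  refine isClosed_property2 hdense (p := fun g h => inner ℂ ((toL2 ∘L conv k) g) h
    = inner ℂ g ((toL2 ∘L conv k) h)) ?_ ?_ g h
  · exact isClosed_eq (by fun_prop) (by fun_prop)
  · intro φ ψ
    simp only [ContinuousLinearMap.comp_apply]
    rw [ContinuousMap.inner_toLp, ContinuousMap.inner_toLp]
    simp only [conv_toL2_apply, ← integral_conj, ← integral_const_mul, ← integral_mul_const]
    rw [integral_integral_swap_of_hasCompactSupport (by fun_prop)
      (HasCompactSupport.of_compactSpace _)]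
    congr 1 with y
    congr 1 with x
    rw [map_mul, ← hk, mul_inv_rev, inv_inv]
    ring

variable (G) in
/-- The functions in `L_2(G)` all of whose Fourier coefficients vanish. -/
def fourierKernel : Submodule ℂ (L2 G) :=
  (Submodule.span ℂ (Set.range fun γ : PontryaginDual G => toL2 (charFn γ)))ᗮ

theorem mem_fourierKernel {g : L2 G} :
    g ∈ fourierKernel G ↔ ∀ γ : PontryaginDual G, inner ℂ (toL2 (charFn γ)) g = 0 := by
  rw [fourierKernel, Submodule.mem_orthogonal]
  constructor
  · intro h γ
    exact h _ (Submodule.subset_span ⟨γ, rfl⟩)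
  · intro h u hu
    induction hu using Submodule.span_induction with
    | mem x hx => obtain ⟨γ, rfl⟩ := hx; exact h γ
    | zero => exact inner_zero_left _
    | add x y _ _ hx hy => rw [inner_add_left, hx, hy, add_zero]
    | smul c x _ hx => rw [inner_smul_left, hx, mul_zero]

theorem translate_mem_fourierKernel {φ : C(G, ℂ)} (hφ : toL2 φ ∈ fourierKernel G) (z : G) :
    toL2 (translate z φ) ∈ fourierKernel G := by
  rw [mem_fourierKernel] at hφ ⊢
  intro γ
  have h := hφ γ
  rw [ContinuousMap.inner_toLp] at h ⊢
  rw [← integral_mul_right_eq_self _ z⁻¹]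
  simp only [translate_apply, inv_mul_cancel_right]
  have : ∀ x, φ x * (starRingEnd ℂ) (charFn γ (x * z⁻¹))
      = φ x * (starRingEnd ℂ) (charFn γ x) * (starRingEnd ℂ) (γ z⁻¹ : ℂ) := fun x => by
    simp only [charFn, ContinuousMap.coe_mk, map_mul, Circle.coe_mul]
    ring
  simp only [this]
  rw [integral_mul_const, h, zero_mul]

theorem conv_translate (k φ : C(G, ℂ)) (z : G) :
    conv k (toL2 (translate z φ)) = translate z (conv k (toL2 φ)) := by
  ext x
  rw [translate_apply, conv_toL2_apply, conv_toL2_apply, ← integral_mul_right_eq_self _ z⁻¹]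
  congr 1 with y
  rw [translate_apply, inv_mul_cancel_right, mul_inv_rev, inv_inv, mul_assoc]

/-- Otherwise the compact symmetric operator on `fourierKernel G` has a nonzero eigenvalue, with a
finite-dimensional, translation-invariant eigenspace. A common eigenvector of the translations there
is a multiple of a character, yet it is orthogonal to all characters. -/
theorem conv_eq_zero_of_symmetric [T2Space G] {k : C(G, ℂ)}
    (hk : ∀ x, k x⁻¹ = (starRingEnd ℂ) (k x)) {g : L2 G} (hg : g ∈ fourierKernel G) :
    conv k g = 0 := by
  have hinj : Function.Injective (toL2 : C(G, ℂ) →L[ℂ] L2 G) :=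
    ContinuousMap.toLp_injective (haar G)
  let T : L2 G →L[ℂ] L2 G := toL2 ∘L conv k
  have hTsymm : T.toLinearMap.IsSymmetric := isSymmetric_conv hk
  have hTinv : ∀ g ∈ fourierKernel G, T g ∈ fourierKernel G := fun g hg => by
    rw [mem_fourierKernel] at hg ⊢
    intro γ
    obtain ⟨c, hc⟩ := conv_charFn k γ
    have h1 : inner ℂ (T (toL2 (charFn γ))) g = inner ℂ (toL2 (charFn γ)) (T g) := hTsymm _ _
    rw [← h1]
    simp only [T, ContinuousLinearMap.comp_apply, hc, map_smul]
    rw [inner_smul_left, hg, mul_zero]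
  have hcomplete : CompleteSpace (fourierKernel G) := by unfold fourierKernel; infer_instance
  let T₀ : fourierKernel G →L[ℂ] fourierKernel G := T.restrict hTinv
  have hT₀c : IsCompactOperator T₀ :=
    IsCompactOperator.restrict' (f := T.toLinearMap)
      ((isCompactOperator_conv k).clm_comp (toL2 : C(G, ℂ) →L[ℂ] L2 G)) hTinv
  have hT₀s : T₀.toLinearMap.IsSymmetric := hTsymm.restrict_invariant hTinv
  have hT₀ : T₀ = 0 := by
    rw [← ContinuousLinearMap.eq_zero_of_forall_hasEigenvalue_eq_zero hT₀c hT₀s]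
    intro μ hμ
    by_contra hμ0
    have hfin := ContinuousLinearMap.finite_dimensional_eigenspace hT₀c μ hμ0
    -- Since `μ ≠ 0`, every eigenvector `v` has the continuous representative `μ⁻¹ • conv k v`.
    -- Working in `C(G, ℂ)` allows evaluation at points, as `exists_eq_smul_char` requires.
    let W : Submodule ℂ C(G, ℂ) :=
      { carrier := {φ | toL2 φ ∈ fourierKernel G ∧ conv k (toL2 φ) = μ • φ}
        add_mem' := fun {φ ψ} hφ hψ => ⟨by rw [map_add]; exact add_mem hφ.1 hψ.1, by
          rw [map_add, map_add, hφ.2, hψ.2, smul_add]⟩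
        zero_mem' := ⟨by rw [map_zero]; exact zero_mem _, by simp⟩
        smul_mem' := fun c φ hφ => ⟨by rw [map_smul]; exact Submodule.smul_mem _ _ hφ.1, by
          rw [map_smul, map_smul, hφ.2, smul_comm]⟩ }
    have hWfin : FiniteDimensional ℂ W := by
      let ι : W →ₗ[ℂ] Module.End.eigenspace T₀.toLinearMap μ :=
        { toFun := fun φ => ⟨⟨toL2 φ.1, φ.2.1⟩, Module.End.mem_eigenspace_iff.2 (Subtype.ext (by
            change toL2 (conv k (toL2 φ.1)) = μ • toL2 φ.1
            rw [φ.2.2, map_smul]))⟩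
          map_add' := fun φ ψ => Subtype.ext (Subtype.ext (map_add toL2 φ.1 ψ.1))
          map_smul' := fun c φ => Subtype.ext (Subtype.ext (map_smul toL2 c φ.1)) }
      refine FiniteDimensional.of_injective ι fun φ ψ h => Subtype.ext (hinj ?_)
      exact congrArg (fun x => x.1.1) h
    have hW0 : W ≠ ⊥ := by
      obtain ⟨v, hv⟩ := hμ.exists_hasEigenvector
      have hv1 : toL2 (conv k (v : L2 G)) = μ • (v : L2 G) :=
        congrArg Subtype.val hv.apply_eq_smul
      have hv2 : toL2 (μ⁻¹ • conv k (v : L2 G)) = v := by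
        rw [map_smul, hv1, smul_smul, inv_mul_cancel₀ hμ0, one_smul]
      intro h
      have hmem : μ⁻¹ • conv k (v : L2 G) ∈ W :=
        ⟨by rw [hv2]; exact v.2, by rw [hv2, smul_smul, mul_inv_cancel₀ hμ0, one_smul]⟩
      rw [h, Submodule.mem_bot] at hmem
      rw [hmem, map_zero] at hv2
      exact hv.2 (Subtype.ext hv2.symm)
    obtain ⟨h, hhW, hh0, hh⟩ := exists_common_eigenvector (translate (G := G))
      (fun y z φ => ContinuousMap.ext fun x => by
        simp only [translate_apply]; rw [mul_right_comm]) W hW0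
      (fun z φ hφ => ⟨translate_mem_fourierKernel hφ.1 z, by
        rw [conv_translate, hφ.2, map_smul]⟩)
    obtain ⟨h10, γ, hγ⟩ := exists_eq_smul_char h hh0 fun z => by
      obtain ⟨c, hc⟩ := hh z
      exact ⟨c, fun x => congrArg (fun f : C(G, ℂ) => f x) hc⟩
    have hsm : h = h 1 • charFn γ := ContinuousMap.ext hγ
    have h1 := mem_fourierKernel.1 hhW.1 γ
    rw [hsm, map_smul, inner_smul_right, mul_eq_zero] at h1
    have h2 : toL2 (charFn γ) = 0 := inner_self_eq_zero.1 (h1.resolve_left (by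
      simpa [charFn] using h10))
    refine hh0 (hinj ?_)
    rw [hsm, map_smul, h2, smul_zero, map_zero]
  refine hinj ?_
  rw [map_zero]
  exact congrArg (fun S : fourierKernel G →L[ℂ] fourierKernel G => (S ⟨g, hg⟩ : L2 G)) hT₀

/-- The characters of a compact abelian group are complete in `L_2(G)`. -/
theorem fourierKernel_eq_bot [T2Space G] : fourierKernel G = ⊥ := by
  rw [eq_bot_iff]
  intro g hg
  have hconv : ∀ k : C(G, ℂ), ∫ y, k y⁻¹ * g y ∂(haar G) = 0 := by
    have hi : ∀ k : C(G, ℂ), Integrable (fun y => k y⁻¹ * g y) (haar G) := fun k => by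
      have hg1 : Integrable g (haar G) := (Lp.memLp g).integrable (by norm_num)
      exact hg1.bdd_mul (c := ‖k‖) (by fun_prop : Continuous fun y => k y⁻¹).aestronglyMeasurable
        (ae_of_all _ fun y => k.norm_coe_le_norm _)
    have hsym : ∀ k : C(G, ℂ), (∀ x, k x⁻¹ = (starRingEnd ℂ) (k x)) →
        ∫ y, k y⁻¹ * g y ∂(haar G) = 0 := fun k hk => by
      have := congrArg (fun f : C(G, ℂ) => f 1) (conv_eq_zero_of_symmetric hk hg)
      simpa [conv_apply] using this
    intro k
    -- Every kernel is `k₁ + i k₂` with both parts Hermitian, which reduces to `hsym`.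
    let k₁ : C(G, ℂ) := ⟨fun x => (k x + (starRingEnd ℂ) (k x⁻¹)) / 2, by fun_prop⟩
    let k₂ : C(G, ℂ) := ⟨fun x => (k x - (starRingEnd ℂ) (k x⁻¹)) / (2 * Complex.I), by fun_prop⟩
    have h1 := hsym k₁ fun x => by simp [k₁, add_comm, Complex.conj_ofNat]
    have h2 := hsym k₂ fun x => by
      simp only [k₂, ContinuousMap.coe_mk, inv_inv, map_div₀, map_sub, map_mul, Complex.conj_I,
        Complex.conj_conj, Complex.conj_ofNat]
      rw [mul_neg, div_neg, ← neg_div, neg_sub]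
    have hk : ∀ y, k y⁻¹ * g y = k₁ y⁻¹ * g y + Complex.I * (k₂ y⁻¹ * g y) := fun y => by
      simp only [k₁, k₂, ContinuousMap.coe_mk]
      field_simp
      ring
    simp only [hk]
    rw [integral_add (hi k₁) ((hi k₂).const_mul _), integral_const_mul, h1, h2]
    simp
  have hdense : DenseRange (toL2 : C(G, ℂ) →L[ℂ] L2 G) :=
    ContinuousMap.toLp_denseRange ℂ (haar G) ℂ (by simp)
  have h0 : ∀ f : L2 G, inner ℂ f g = 0 := fun f => by
    refine isClosed_property hdense (p := fun f => inner ℂ f g = 0)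
      (isClosed_eq (by fun_prop) continuous_const) (fun φ => ?_) f
    rw [inner_toL2]
    have := hconv ⟨fun y => (starRingEnd ℂ) (φ y⁻¹), by fun_prop⟩
    simpa [mul_comm] using this
  exact inner_self_eq_zero.1 (h0 g)

theorem fourierCoeff_eq_inner {f : G → ℂ} (hf : MemLp f 2 (haar G)) (γ : PontryaginDual G) :
    fourierCoeff f γ = inner ℂ (toL2 (charFn γ)) hf.toLp := by
  rw [inner_toL2]
  refine integral_congr_ae ?_
  filter_upwards [hf.coeFn_toLp] with x hx
  rw [hx]
  rfl

/-- A function in `L_2(G)` is determined by its Fourier coefficients. -/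
theorem L2_ext [T2Space G] {f g : L2 G}
    (h : ∀ γ : PontryaginDual G, inner ℂ (toL2 (charFn γ)) f = inner ℂ (toL2 (charFn γ)) g) :
    f = g := by
  have : f - g ∈ fourierKernel G := mem_fourierKernel.2 fun γ => by
    rw [inner_sub_right, h, sub_self]
  rw [fourierKernel_eq_bot, Submodule.mem_bot] at this
  exact sub_eq_zero.1 this

end Groups

/-! ### Null sets along orbits -/

section Groups

variable {G : Type u} [CommGroup G] [TopologicalSpace G] [IsTopologicalGroup G] [CompactSpace G]
  [MeasurableSpace G] [BorelSpace G]

/-- A property which holds almost everywhere on `G` holds almost everywhere on almost every orbit. -/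
theorem ae_ae_orbit {β : Multiplicative ℝ →ₜ* G} {p : G → Prop} (hp : ∀ᵐ ω ∂(haar G), p ω) :
    ∀ᵐ ω ∂(haar G), ∀ᵐ t : ℝ, p (ω * β (Multiplicative.ofAdd t)) := by
  obtain ⟨s, hs, hsm, hs0⟩ := exists_measurable_superset_of_null (ae_iff.1 hp)
  have hcont : Continuous fun x : G × ℝ => x.1 * β (Multiplicative.ofAdd x.2) :=
    continuous_fst.mul ((map_continuous β).comp (continuous_ofAdd.comp continuous_snd))
  obtain ⟨q, hq⟩ : ∃ q : G → ℝ → Prop, q = fun ω t => ω * β (Multiplicative.ofAdd t) ∉ s :=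
    ⟨_, rfl⟩
  -- Borel sets of `G × ℝ` are measurable for the product σ-algebra because `ℝ` is second countable,
  -- even if `G` is not.
  have hms : MeasurableSet {x : G × ℝ | q x.1 x.2} := by
    rw [hq]; exact hcont.measurable hsm.compl
  have h : ∀ᵐ ω ∂(haar G), ∀ᵐ t : ℝ, q ω t := by
    rw [Measure.ae_ae_comm hms, hq]
    have hs' : ∀ᵐ ω ∂(haar G), ω ∉ s := measure_eq_zero_iff_ae_notMem.1 hs0
    refine ae_of_all _ fun t => ?_
    have hmp : Measure.QuasiMeasurePreserving (fun ω : G => ω * β (Multiplicative.ofAdd t))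
        (haar G) (haar G) := (measurePreserving_mul_right (haar G) _).quasiMeasurePreserving
    have h3 := hmp.ae hs'
    exact h3
  rw [hq] at h
  filter_upwards [h] with ω hω
  filter_upwards [hω] with t ht
  by_contra hn
  exact ht (hs hn)

end Groups

/-! ### Gaussian means of character series -/

/-- The coefficients of a Dirichlet series, damped by a Gaussian factor. -/
def gaussCoeff (lam : ℕ → ℝ) (a : ℕ → ℂ) (r : ℝ) (n : ℕ) : ℂ :=
  a n * (Real.exp (-(r * lam n) ^ 2 / 2) : ℂ)

theorem norm_gaussCoeff_le (lam : ℕ → ℝ) (a : ℕ → ℂ) (r : ℝ) (n : ℕ) :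
    ‖gaussCoeff lam a r n‖ ≤ ‖a n‖ := by
  rw [gaussCoeff, norm_mul, Complex.norm_real, Real.norm_eq_abs, Real.abs_exp]
  refine mul_le_of_le_one_right (norm_nonneg _) (Real.exp_le_one_iff.2 ?_)
  nlinarith [sq_nonneg (r * lam n)]

/-- As soon as `lam n ≥ 2σ / r²`, the Gaussian factor is at most `exp(-σ lam n)`, which is summable
for a suitable `σ`. -/
theorem summable_gaussCoeff {lam : ℕ → ℝ} (hlam : IsFrequency lam) (hL : L lam < ⊤) {a : ℕ → ℂ}
    {C : ℝ} (ha : ∀ n, ‖a n‖ ≤ C) {r : ℝ} (hr : r ≠ 0) :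
    Summable fun n => ‖gaussCoeff lam a r n‖ := by
  obtain ⟨σ, hσ, hsum⟩ := exists_summable_exp hlam hL
  have hr2 : 0 < r ^ 2 := by positivity
  refine Summable.of_norm_bounded_eventually_nat (hsum.mul_left C) ?_
  filter_upwards [hlam.tendsto.eventually_ge_atTop (2 * σ / r ^ 2)] with n hn
  rw [norm_norm, gaussCoeff, norm_mul, Complex.norm_real, Real.norm_eq_abs, Real.abs_exp]
  refine mul_le_mul (ha n) (Real.exp_le_exp.2 ?_) (Real.exp_pos _).le ((norm_nonneg _).trans (ha n))
  rw [div_le_iff₀ hr2] at hn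
  nlinarith [hlam.nonneg n, mul_le_mul_of_nonneg_left hn (hlam.nonneg n)]

theorem tendsto_gaussCoeff (lam : ℕ → ℝ) (a : ℕ → ℂ) (n : ℕ) {r : ℕ → ℝ}
    (hr : Tendsto r atTop (𝓝 0)) :
    Tendsto (fun k => gaussCoeff lam a (r k) n) atTop (𝓝 (a n)) := by
  have hc : Continuous fun x : ℝ => gaussCoeff lam a x n := by unfold gaussCoeff; fun_prop
  have := (hc.tendsto 0).comp hr
  simpa [gaussCoeff, Function.comp_def] using this

section Groups

variable {G : Type u} [CommGroup G] [TopologicalSpace G]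

theorem char_injective {lam : ℕ → ℝ} (hlam : IsFrequency lam) {β : Multiplicative ℝ →ₜ* G}
    (hβ : IsDirichletGroup lam β) : Function.Injective hβ.char := by
  intro n m h
  refine hlam.strictMono.injective ?_
  by_contra hne
  have hne' : (lam n : ℂ) - lam m ≠ 0 := by
    rw [← Complex.ofReal_sub]; exact Complex.ofReal_ne_zero.2 (sub_ne_zero.2 hne)
  -- At this time the two exponentials differ by the factor `exp(-iπ) = -1`.
  set t : ℝ := Real.pi / (lam n - lam m) with ht
  have h1 := hβ.char_apply n t
  rw [h, hβ.char_apply m t] at h1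
  have h2 : Complex.exp (-Complex.I * lam n * t) =
      Complex.exp (-Complex.I * lam m * t) * Complex.exp (-(Real.pi * Complex.I)) := by
    rw [← Complex.exp_add]
    congr 1
    rw [ht]; push_cast; field_simp; ring
  rw [h2, Complex.exp_neg, Complex.exp_pi_mul_I] at h1
  have h3 := Complex.exp_ne_zero (-Complex.I * lam m * t)
  apply h3
  linear_combination (1 / 2 : ℂ) * h1

theorem norm_charFn_apply (γ : PontryaginDual G) (x : G) : ‖charFn γ x‖ = 1 := Circle.norm_coe _

theorem norm_charFn_le [CompactSpace G] (γ : PontryaginDual G) : ‖charFn γ‖ ≤ 1 :=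
  (ContinuousMap.norm_le _ zero_le_one).2 fun x => (norm_charFn_apply γ x).le

/-- The Gaussian mean of `∑ aₙ h_{lamₙ}`. -/
def gaussSum {lam : ℕ → ℝ} {β : Multiplicative ℝ →ₜ* G} (hβ : IsDirichletGroup lam β) (a : ℕ → ℂ) (r : ℝ) : C(G, ℂ) :=
  ∑' n, gaussCoeff lam a r n • charFn (hβ.char n)

theorem hasSum_gaussSum [CompactSpace G] {lam : ℕ → ℝ}
    {β : Multiplicative ℝ →ₜ* G} (hβ : IsDirichletGroup lam β) {a : ℕ → ℂ} {r : ℝ}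
    (hs : Summable fun n => ‖gaussCoeff lam a r n‖) :
    HasSum (fun n => gaussCoeff lam a r n • charFn (hβ.char n)) (gaussSum hβ a r) := by
  refine Summable.hasSum (Summable.of_norm_bounded hs fun n => ?_)
  rw [norm_smul]
  exact mul_le_of_le_one_right (norm_nonneg _) (norm_charFn_le _)

theorem hasSum_gaussSum_apply [CompactSpace G] {lam : ℕ → ℝ}
    {β : Multiplicative ℝ →ₜ* G} (hβ : IsDirichletGroup lam β) {a : ℕ → ℂ} {r : ℝ}
    (hs : Summable fun n => ‖gaussCoeff lam a r n‖) (ω : G) :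
    HasSum (fun n => gaussCoeff lam a r n * (hβ.char n ω : ℂ)) (gaussSum hβ a r ω) :=
  ContinuousMap.hasSum_apply (hasSum_gaussSum hβ hs) ω

variable [IsTopologicalGroup G] [CompactSpace G] [MeasurableSpace G] [BorelSpace G]

/-- Translating by `z` multiplies the inner product of two characters by the value of their quotient
at `z`; if the inner product is nonzero, that quotient is identically `1`. -/
theorem orthonormal_charFn : Orthonormal ℂ fun γ : PontryaginDual G => toL2 (charFn γ) := by
  classical
  rw [orthonormal_iff_ite]
  intro γ γ'
  rw [ContinuousMap.inner_toLp]
  split_ifs with h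
  · subst h
    have : ∀ x, charFn γ x * (starRingEnd ℂ) (charFn γ x) = 1 := fun x => by
      rw [Complex.mul_conj, Complex.normSq_eq_norm_sq, norm_charFn_apply]; simp
    simp [this]
  · by_contra h0
    refine h (PontryaginDual.ext fun z => Circle.ext ?_)
    have h1 := integral_mul_right_eq_self (μ := haar G)
      (fun x => charFn γ' x * (starRingEnd ℂ) (charFn γ x)) z
    have h2 : ∀ x, charFn γ' (x * z) * (starRingEnd ℂ) (charFn γ (x * z)) =
        charFn γ' z * (starRingEnd ℂ) (charFn γ z) *
          (charFn γ' x * (starRingEnd ℂ) (charFn γ x)) := fun x => by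
      simp only [charFn, ContinuousMap.coe_mk, map_mul, Circle.coe_mul]
      ring
    simp only [h2] at h1
    rw [integral_const_mul] at h1
    have h3 : charFn γ' z * (starRingEnd ℂ) (charFn γ z) = 1 :=
      mul_right_cancel₀ h0 (h1.trans (one_mul _).symm)
    have h4 : charFn γ z * (starRingEnd ℂ) (charFn γ z) = 1 := by
      rw [Complex.mul_conj, Complex.normSq_eq_norm_sq, norm_charFn_apply]; simp
    have h5 : (starRingEnd ℂ) (charFn γ z) ≠ 0 := right_ne_zero_of_mul_eq_one h4
    exact mul_right_cancel₀ h5 (h4.trans h3.symm)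

/-! ### Averaging along the flow -/

/-- Translation along the flow `β` on `L_2(G)`. -/
def flow (β : Multiplicative ℝ →ₜ* G) (t : ℝ) : L2 G →ₗᵢ[ℂ] L2 G :=
  Lp.compMeasurePreservingₗᵢ ℂ (fun ω => ω * β (Multiplicative.ofAdd t))
    (measurePreserving_mul_right (haar G) _)

theorem flow_ae_eq (β : Multiplicative ℝ →ₜ* G) (t : ℝ) (f : L2 G) :
    flow β t f =ᵐ[haar G] fun ω => f (ω * β (Multiplicative.ofAdd t)) :=
  Lp.coeFn_compMeasurePreserving f (measurePreserving_mul_right (haar G) _)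

theorem flow_zero (β : Multiplicative ℝ →ₜ* G) (f : L2 G) : flow β 0 f = f := by
  refine Lp.ext ((flow_ae_eq β 0 f).trans (ae_of_all _ fun ω => ?_))
  simp

theorem continuous_flow [T2Space G] (β : Multiplicative ℝ →ₜ* G) (f : L2 G) :
    Continuous fun t => flow β t f := by
  have hc : Continuous fun x : ℝ × G => x.2 * β (Multiplicative.ofAdd x.1) :=
    continuous_snd.mul ((map_continuous β).comp (continuous_ofAdd.comp continuous_fst))
  exact Continuous.compMeasurePreservingLp (μ := haar G) (ν := haar G) (p := 2)
    (f := fun _ : ℝ => f) (g := ContinuousMap.curry ⟨_, hc⟩) continuous_const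
    (ContinuousMap.continuous _) 
    (fun t => measurePreserving_mul_right (haar G) (β (Multiplicative.ofAdd t))) (by simp)

theorem inner_flow (β : Multiplicative ℝ →ₜ* G) (t : ℝ) (f : L2 G) (γ : PontryaginDual G) :
    inner ℂ (toL2 (charFn γ)) (flow β t f)
      = (γ (β (Multiplicative.ofAdd t)) : ℂ) * inner ℂ (toL2 (charFn γ)) f := by
  rw [inner_toL2, inner_toL2, ← integral_const_mul]
  set z := β (Multiplicative.ofAdd t)
  have h1 : ∫ x, (flow β t f) x * (starRingEnd ℂ) (charFn γ x) ∂(haar G)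
      = ∫ x, f (x * z) * (starRingEnd ℂ) (charFn γ x) ∂(haar G) := by
    refine integral_congr_ae ?_
    filter_upwards [flow_ae_eq β t f] with x hx
    rw [hx]
  have hz : (γ z : ℂ) * (starRingEnd ℂ) (γ z : ℂ) = 1 := by
    rw [Complex.mul_conj, Circle.normSq_coe, Complex.ofReal_one]
  rw [h1, ← integral_mul_right_eq_self (fun x => (γ z : ℂ) * _) z]
  congr 1 with x
  simp only [charFn, ContinuousMap.coe_mk, map_mul, Circle.coe_mul]
  linear_combination (-f (x * z) * (starRingEnd ℂ) (γ x : ℂ)) * hz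

/-- The Gaussian mean of `f` along the flow `β`. -/
def flowMean (β : Multiplicative ℝ →ₜ* G) (r : ℝ) (f : L2 G) : L2 G :=
  ∫ t, flow β (r * t) f ∂(ProbabilityTheory.gaussianReal 0 1)

theorem integrable_flow [T2Space G] (β : Multiplicative ℝ →ₜ* G) (r : ℝ) (f : L2 G) :
    Integrable (fun t => flow β (r * t) f) (ProbabilityTheory.gaussianReal 0 1) := by
  refine Integrable.mono' (integrable_const ‖f‖)
    ((continuous_flow β f).comp (continuous_const.mul continuous_id)).aestronglyMeasurable
    (ae_of_all _ fun t => ?_)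
  rw [LinearIsometry.norm_map]

theorem inner_flowMean [T2Space G] (β : Multiplicative ℝ →ₜ* G) (r : ℝ) (f : L2 G)
    (γ : PontryaginDual G) :
    inner ℂ (toL2 (charFn γ)) (flowMean β r f)
      = (∫ t, (γ (β (Multiplicative.ofAdd (r * t))) : ℂ) ∂(ProbabilityTheory.gaussianReal 0 1))
        * inner ℂ (toL2 (charFn γ)) f := by
  rw [flowMean, ← integral_inner (integrable_flow β r f), ← integral_mul_const]
  simp only [inner_flow]

theorem tendsto_flowMean [T2Space G] (β : Multiplicative ℝ →ₜ* G) (f : L2 G) {r : ℕ → ℝ}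
    (hr : Tendsto r atTop (𝓝 0)) : Tendsto (fun k => flowMean β (r k) f) atTop (𝓝 f) := by
  have h1 : f = ∫ _ : ℝ, f ∂(ProbabilityTheory.gaussianReal 0 1) := by simp
  conv => rhs; rw [h1]
  refine tendsto_integral_of_dominated_convergence (fun _ => ‖f‖)
    (fun k => (integrable_flow β (r k) f).aestronglyMeasurable) (integrable_const _)
    (fun k => ae_of_all _ fun t => by rw [LinearIsometry.norm_map]) (ae_of_all _ fun t => ?_)
  have h2 := ((continuous_flow β f).tendsto (0 * t)).comp (hr.mul_const t)
  rwa [zero_mul, flow_zero] at h2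

variable (G) in
/-- The functions in `L_2(G)` which are bounded by `C` almost everywhere. -/
def aeBounded (C : ℝ) : Set (L2 G) := {f | ∀ᵐ ω ∂(haar G), ‖f ω‖ ≤ C}

theorem isClosed_aeBounded (C : ℝ) : IsClosed (aeBounded G C) := by
  refine IsSeqClosed.isClosed fun f g hf hg => ?_
  obtain ⟨ns, -, hns⟩ := (tendstoInMeasure_of_tendsto_Lp hg).exists_seq_tendsto_ae
  have hall : ∀ᵐ ω ∂(haar G), ∀ k, ‖f (ns k) ω‖ ≤ C := ae_all_iff.2 fun k => hf (ns k)
  change ∀ᵐ ω ∂(haar G), ‖g ω‖ ≤ C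
  filter_upwards [hns, hall] with ω h1 h2
  exact le_of_tendsto h1.norm (Eventually.of_forall h2)

theorem convex_aeBounded (C : ℝ) : Convex ℝ (aeBounded G C) := by
  intro f hf g hg x y hx hy hxy
  change ∀ᵐ ω ∂(haar G), ‖(x • f + y • g : L2 G) ω‖ ≤ C
  filter_upwards [hf, hg, Lp.coeFn_add (x • f) (y • g), Lp.coeFn_smul x f, Lp.coeFn_smul y g]
    with ω h1 h2 h3 h4 h5
  rw [h3, Pi.add_apply, h4, h5, Pi.smul_apply, Pi.smul_apply]
  refine (norm_add_le _ _).trans ?_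
  rw [norm_smul, norm_smul, Real.norm_of_nonneg hx, Real.norm_of_nonneg hy]
  calc x * ‖f ω‖ + y * ‖g ω‖ ≤ x * C + y * C := by gcongr
    _ = C := by rw [← add_mul, hxy, one_mul]

/-- All translates lie in the closed convex set `aeBounded G C`, hence so does their mean for a
probability measure. No pointwise formula for the `L²`-valued integral is needed. -/
theorem flowMean_mem_aeBounded [T2Space G] (β : Multiplicative ℝ →ₜ* G) (r : ℝ) {f : L2 G} {C : ℝ}
    (hf : f ∈ aeBounded G C) : flowMean β r f ∈ aeBounded G C := by
  refine (convex_aeBounded C).integral_mem (isClosed_aeBounded C) (ae_of_all _ fun t => ?_)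
    (integrable_flow β r f)
  have h := (measurePreserving_mul_right (haar G)
    (β (Multiplicative.ofAdd (r * t)))).quasiMeasurePreserving.ae hf
  change ∀ᵐ ω ∂(haar G), ‖flow β (r * t) f ω‖ ≤ C
  filter_upwards [h, flow_ae_eq β (r * t) f] with ω h1 h2
  rwa [h2]

variable {lam : ℕ → ℝ} {β : Multiplicative ℝ →ₜ* G}

/-- The Fourier coefficients of a sum of multiples of the characters `h_{lamₙ}`. -/
theorem inner_of_hasSum (hlam : IsFrequency lam) (hβ : IsDirichletGroup lam β) {c : ℕ → ℂ}
    {f : L2 G} (hf : HasSum (fun n => c n • toL2 (charFn (hβ.char n))) f) :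
    (∀ n, inner ℂ (toL2 (charFn (hβ.char n))) f = c n) ∧
      ∀ γ, γ ∉ Set.range hβ.char → inner ℂ (toL2 (charFn γ)) f = 0 := by
  classical
  have hon := orthonormal_iff_ite.1 (orthonormal_charFn (G := G))
  have hs : ∀ γ, HasSum (fun n => c n * if γ = hβ.char n then 1 else 0)
      (inner ℂ (toL2 (charFn γ)) f) := fun γ => by
    have := hf.mapL (innerSL ℂ (toL2 (charFn γ)))
    simpa only [innerSL_apply_apply, inner_smul_right, hon] using this
  constructor
  · intro n
    refine (hs (hβ.char n)).unique ?_
    have := hasSum_single (f := fun m => c m * if hβ.char n = hβ.char m then (1 : ℂ) else 0) n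
      fun m hm => by
        rw [if_neg fun h => hm (char_injective hlam hβ h).symm, mul_zero]
    simpa using this
  · intro γ hγ
    refine (hs γ).unique ?_
    have : ∀ n, γ ≠ hβ.char n := fun n h => hγ ⟨n, h.symm⟩
    simp [this, hasSum_zero]

/-- `f` has the Fourier coefficients `aₙ` at `h_{lamₙ}`, and no others. -/
def HasFourierSeries (hβ : IsDirichletGroup lam β) (a : ℕ → ℂ) (f : L2 G) : Prop :=
  (∀ n, inner ℂ (toL2 (charFn (hβ.char n))) f = a n) ∧
    ∀ γ, γ ∉ Set.range hβ.char → inner ℂ (toL2 (charFn γ)) f = 0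

theorem HasFourierSeries.norm_le {hβ : IsDirichletGroup lam β} {a : ℕ → ℂ} {f : L2 G}
    (hf : HasFourierSeries hβ a f) (n : ℕ) : ‖a n‖ ≤ ‖f‖ := by
  rw [← hf.1 n]
  refine (norm_inner_le_norm _ _).trans (le_of_eq ?_)
  rw [orthonormal_charFn.1 (hβ.char n), one_mul]

/-- Both sides have the same Fourier coefficients: the multiplier in `inner_flowMean` at `h_{lamₙ}`
is the characteristic function of the standard Gaussian at `-r lamₙ`. -/
theorem HasFourierSeries.flowMean_eq [T2Space G] (hlam : IsFrequency lam)
    {hβ : IsDirichletGroup lam β} {a : ℕ → ℂ} {f : L2 G} (hf : HasFourierSeries hβ a f) {r : ℝ}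
    (hs : Summable fun n => ‖gaussCoeff lam a r n‖) :
    flowMean β r f = toL2 (gaussSum hβ a r) := by
  have hsum := (hasSum_gaussSum hβ hs).mapL (toL2 (G := G))
  simp only [map_smul] at hsum
  obtain ⟨h1, h2⟩ := inner_of_hasSum hlam hβ hsum
  refine L2_ext fun γ => ?_
  rw [inner_flowMean]
  by_cases hγ : γ ∈ Set.range hβ.char
  · obtain ⟨n, rfl⟩ := hγ
    rw [h1, hf.1, gaussCoeff, mul_comm]
    congr 1
    simp only [hβ.char_apply]
    have := ProbabilityTheory.charFun_gaussianReal (μ := 0) (v := 1) (-(r * lam n))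
    rw [charFun_apply_real] at this
    refine Eq.trans ?_ (this.trans ?_)
    · congr 1 with t
      congr 1
      push_cast; ring
    · rw [Complex.ofReal_exp]
      congr 1
      push_cast; ring
  · rw [h2 γ hγ, hf.2 γ hγ, mul_zero]

/-- The mean inherits the almost everywhere bound. A set of full Haar measure is dense and the sum
is continuous, so the bound holds at every point, in particular along every orbit. -/
theorem HasFourierSeries.norm_gaussSum_le [T2Space G] (hlam : IsFrequency lam)
    {hβ : IsDirichletGroup lam β} {a : ℕ → ℂ} {f : L2 G} (hf : HasFourierSeries hβ a f) {C : ℝ}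
    (hC : f ∈ aeBounded G C) {r : ℝ} (hs : Summable fun n => ‖gaussCoeff lam a r n‖) (ω : G) :
    ‖gaussSum hβ a r ω‖ ≤ C := by
  have h1 := flowMean_mem_aeBounded β r hC
  rw [hf.flowMean_eq hlam hs] at h1
  have h2 : ∀ᵐ ω ∂(haar G), ‖gaussSum hβ a r ω‖ ≤ C := by
    filter_upwards [h1, ContinuousMap.coeFn_toLp (𝕜 := ℂ) (p := 2) (haar G) (gaussSum hβ a r)]
      with x hx hx2
    rwa [← hx2]
  have hd : Dense {ω | ‖gaussSum hβ a r ω‖ ≤ C} := Measure.dense_of_ae h2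
  have hcl : IsClosed {ω | ‖gaussSum hβ a r ω‖ ≤ C} := isClosed_le (by fun_prop) continuous_const
  have := hd.closure_eq
  rw [hcl.closure_eq] at this
  exact Set.eq_univ_iff_forall.1 this ω

theorem HasFourierSeries.exists_tendsto_ae [T2Space G] (hlam : IsFrequency lam)
    {hβ : IsDirichletGroup lam β} {a : ℕ → ℂ} {f : L2 G} (hf : HasFourierSeries hβ a f)
    (hs : ∀ r ≠ 0, Summable fun n => ‖gaussCoeff lam a r n‖) :
    ∃ r : ℕ → ℝ, (∀ k, r k ≠ 0) ∧ Tendsto r atTop (𝓝 0) ∧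
      ∀ᵐ ω ∂(haar G), Tendsto (fun k => gaussSum hβ a (r k) ω) atTop (𝓝 (f ω)) := by
  set r : ℕ → ℝ := fun k => 1 / ((k : ℝ) + 1) with hr
  have hr0 : ∀ k, r k ≠ 0 := fun k => by positivity
  have hrt : Tendsto r atTop (𝓝 0) := tendsto_one_div_add_atTop_nhds_zero_nat
  obtain ⟨ns, hns, hlim⟩ := (tendstoInMeasure_of_tendsto_Lp
    (tendsto_flowMean β f hrt)).exists_seq_tendsto_ae
  refine ⟨r ∘ ns, fun k => hr0 _, hrt.comp hns.tendsto_atTop, ?_⟩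
  have hall : ∀ᵐ ω ∂(haar G), ∀ k, flowMean β (r (ns k)) f ω = gaussSum hβ a (r (ns k)) ω :=
    ae_all_iff.2 fun k => by
      rw [hf.flowMean_eq hlam (hs _ (hr0 _))]
      exact ContinuousMap.coeFn_toLp _ _
  filter_upwards [hlim, hall] with ω h1 h2
  simp only [h2] at h1
  exact h1

theorem MemHardy.memLp_two {hβ : IsDirichletGroup lam β} {f : G → ℂ} (hf : MemHardy hβ ∞ f) :
    MemLp f 2 (haar G) := hf.1.mono_exponent le_top

theorem MemHardy.hasFourierSeries {hβ : IsDirichletGroup lam β} {f : G → ℂ}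
    (hf : MemHardy hβ ∞ f) : HasFourierSeries hβ (bohrMap hβ f) hf.memLp_two.toLp := by
  refine ⟨fun n => (fourierCoeff_eq_inner hf.memLp_two _).symm, fun γ hγ => ?_⟩
  rw [← fourierCoeff_eq_inner]
  by_contra h
  exact hγ (hf.2 γ h)

theorem MemHardy.exists_bound {hβ : IsDirichletGroup lam β} {f : G → ℂ} (hf : MemHardy hβ ∞ f) :
    ∃ C : ℝ, ∀ᵐ ω ∂(haar G), ‖f ω‖ ≤ C := by
  have h := hf.1.2
  rw [eLpNorm_exponent_top] at h
  refine ⟨(eLpNormEssSup f (haar G)).toReal, ?_⟩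
  filter_upwards [ae_le_eLpNormEssSup (f := f) (μ := haar G)] with ω hω
  rw [← toReal_enorm]
  exact ENNReal.toReal_mono h.ne hω

theorem MemHardy.exists_aeBounded {hβ : IsDirichletGroup lam β} {f : G → ℂ}
    (hf : MemHardy hβ ∞ f) : ∃ C : ℝ, hf.memLp_two.toLp ∈ aeBounded G C := by
  obtain ⟨C, hC⟩ := hf.exists_bound
  refine ⟨C, ?_⟩
  change ∀ᵐ ω ∂(haar G), ‖hf.memLp_two.toLp f ω‖ ≤ C
  filter_upwards [hC, hf.memLp_two.coeFn_toLp] with ω h1 h2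
  rwa [h2]

/-! ### Independence of the Dirichlet group -/

/-- A series in `𝓗_∞(lam)` comes from a function in `H_∞^lam(G)` for every `lam`-Dirichlet group
`(G, β)`. -/
theorem exists_memHardy_of_mem_hardyDirichlet [T2Space G] (hlam : IsFrequency lam)
    (hL : L lam < ⊤) (hβ : IsDirichletGroup lam β) {a : ℕ → ℂ}
    (ha : a ∈ HardyDirichlet.{v} lam ∞) : ∃ f : G → ℂ, MemHardy hβ ∞ f ∧ bohrMap hβ f = a := by
  obtain ⟨G₀, _, _, _, _, _, _, _, β₀, hβ₀, f₀, hf₀, rfl⟩ := ha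
  set a := bohrMap hβ₀ f₀
  have hfs₀ := hf₀.hasFourierSeries
  obtain ⟨C, hC⟩ := hf₀.exists_aeBounded
  have hs : ∀ r ≠ 0, Summable fun n => ‖gaussCoeff lam a r n‖ := fun r hr =>
    summable_gaussCoeff hlam hL hfs₀.norm_le hr
  have hbound : ∀ r ≠ 0, ∀ ω, ‖gaussSum hβ a r ω‖ ≤ C := by
    intro r hr ω
    have hcl : IsClosed {ω | ‖gaussSum hβ a r ω‖ ≤ C} := isClosed_le (by fun_prop) continuous_const
    -- At `β(t)` and `β₀(t)` the two Gaussian sums are the same numerical series, so the bound known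
    -- on `G₀` holds on a dense subset of `G`.
    refine hβ.denseRange.induction_on (p := fun ω => ‖gaussSum hβ a r ω‖ ≤ C) ω hcl fun t => ?_
    have h1 := hasSum_gaussSum_apply hβ (hs r hr) (β (Multiplicative.ofAdd t.toAdd))
    have h2 := hasSum_gaussSum_apply hβ₀ (hs r hr) (β₀ (Multiplicative.ofAdd t.toAdd))
    simp only [IsDirichletGroup.char_apply] at h1 h2
    have h3 := h1.unique h2
    rw [ofAdd_toAdd] at h3
    rw [h3]
    exact hfs₀.norm_gaussSum_le hlam hC (hs r hr) _
  have hon := (orthonormal_charFn (G := G)).comp _ (char_injective hlam hβ)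
  -- Bessel's inequality on `G₀` makes the coefficients square summable, which provides an `L²`
  -- function on `G`; its boundedness comes afterwards from the Gaussian means.
  have hl2 : Summable fun n => ‖a n‖ ^ 2 := by
    have := ((orthonormal_charFn (G := G₀)).comp _
      (char_injective hlam hβ₀)).inner_products_summable hf₀.memLp_two.toLp
    refine this.congr fun n => ?_
    rw [Function.comp_apply, hfs₀.1 n]
  have hsum : Summable fun n => a n • toL2 (charFn (hβ.char n)) :=
    (hon.orthogonalFamily.summable_iff_norm_sq_summable a).2 hl2
  obtain ⟨f, hf⟩ := hsum
  have hfs : HasFourierSeries hβ a f := inner_of_hasSum hlam hβ hf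
  have hfC : f ∈ aeBounded G C := by
    obtain ⟨r, hr0, -, hlim⟩ := hfs.exists_tendsto_ae hlam hs
    change ∀ᵐ ω ∂(haar G), ‖f ω‖ ≤ C
    filter_upwards [hlim] with ω hω
    exact le_of_tendsto hω.norm (Eventually.of_forall fun k => hbound _ (hr0 k) ω)
  have hcoeff : ∀ γ, fourierCoeff f γ = inner ℂ (toL2 (charFn γ)) f := fun γ => by
    rw [fourierCoeff_eq_inner (Lp.memLp f), Lp.toLp_coeFn]
  refine ⟨f, ⟨memLp_top_of_bound (Lp.aestronglyMeasurable f) C hfC, fun γ hγ => ?_⟩, ?_⟩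
  · by_contra h
    exact hγ ((hcoeff γ).trans (hfs.2 γ h))
  · funext n
    exact (hcoeff _).trans (hfs.1 n)

end Groups

/-! ### Poisson integrals on the line and convergence of vertical limits -/

theorem poissonConv_eq_integral (u : ℝ) (g : ℝ → ℂ) (t : ℝ) :
    poissonConv u g t = ∫ y, poissonKernel u y • g (t - y) := rfl

theorem isOpen_rightHalfPlane : IsOpen {s : ℂ | 0 < s.re} :=
  isOpen_lt continuous_const Complex.continuous_re

theorem norm_exp_neg_mul (x : ℝ) (s : ℂ) :
    ‖Complex.exp (-(x : ℂ) * s)‖ = Real.exp (-x * s.re) := by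
  rw [Complex.norm_exp]; simp

theorem norm_exp_imag (x t : ℝ) : ‖Complex.exp (-Complex.I * x * t)‖ = 1 := by
  rw [Complex.norm_exp]; simp

theorem term_eq (lam : ℕ → ℝ) (c : ℕ → ℂ) (s : ℂ) (n : ℕ) :
    term lam c s n = c n * Complex.exp (-(lam n : ℂ) * s) := rfl

theorem norm_term_le {lam : ℕ → ℝ} (hlam : IsFrequency lam) (c : ℕ → ℂ) {s : ℂ} (hs : 0 < s.re)
    (n : ℕ) : ‖term lam c s n‖ ≤ ‖c n‖ := by
  rw [term_eq, norm_mul, norm_exp_neg_mul]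
  refine mul_le_of_le_one_right (norm_nonneg _) (Real.exp_le_one_iff.2 ?_)
  nlinarith [hlam.nonneg n]

/-- An absolutely convergent general Dirichlet series is the Poisson integral of its boundary
values. -/
theorem poissonConv_tsum {lam : ℕ → ℝ} {c : ℕ → ℂ} (hc : Summable fun n => ‖c n‖)
    (hlam : IsFrequency lam) {u : ℝ} (hu : 0 < u) (t : ℝ) :
    poissonConv u (fun t : ℝ => ∑' n, c n * Complex.exp (-Complex.I * lam n * t)) t
      = ∑' n, term lam c ((u : ℂ) + t * Complex.I) n := by
  set f : ℕ → ℝ → ℂ := fun n y =>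
    poissonKernel u y • (c n * Complex.exp (-Complex.I * lam n * (t - y : ℝ))) with hf
  have hnorm : ∀ n y, ‖f n y‖ = ‖c n‖ * poissonKernel u y := fun n y => by
    simp only [hf]
    rw [norm_smul, norm_mul, norm_exp_imag, mul_one, Real.norm_of_nonneg (poissonKernel_nonneg hu y),
      mul_comm]
  have hP := integrable_poissonKernel hu
  have hint : ∀ n, Integrable (f n) := fun n => by
    refine Integrable.mono' (hP.const_mul ‖c n‖) ?_ (ae_of_all _ fun y => (hnorm n y).le)
    exact hP.aestronglyMeasurable.smul (by fun_prop : Continuous fun y : ℝ =>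
      c n * Complex.exp (-Complex.I * lam n * (t - y : ℝ))).aestronglyMeasurable
  have hval : ∀ n, ∫ y, f n y = term lam c ((u : ℂ) + t * Complex.I) n := fun n => by
    have h1 : ∀ y, f n y = c n * Complex.exp (-Complex.I * lam n * t) *
        ((poissonKernel u y : ℂ) * Complex.exp (Complex.I * lam n * y)) := fun y => by
      simp only [hf, Complex.real_smul]
      have : Complex.exp (-Complex.I * lam n * (t - y : ℝ)) =
          Complex.exp (-Complex.I * lam n * t) * Complex.exp (Complex.I * lam n * y) := by
        rw [← Complex.exp_add]; congr 1; push_cast; ring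
      rw [this]; ring
    simp only [h1]
    rw [integral_const_mul, integral_poissonKernel_mul_exp hu (hlam.nonneg n), term_eq, mul_assoc,
      ← Complex.exp_add]
    congr 2; ring
  have hsum := hasSum_integral_of_summable_integral_norm hint (by
    simp only [hnorm, integral_const_mul, integral_poissonKernel hu, mul_one]; exact hc)
  simp only [hval] at hsum
  rw [hsum.tsum_eq, poissonConv_eq_integral]
  congr 1 with y
  simp only [hf]
  rw [tsum_const_smul'']

theorem differentiableOn_tsum_term {lam : ℕ → ℝ} {c : ℕ → ℂ} (hc : Summable fun n => ‖c n‖)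
    (hlam : IsFrequency lam) :
    DifferentiableOn ℂ (fun s => ∑' n, term lam c s n) {s : ℂ | 0 < s.re} := by
  refine differentiableOn_of_hasValueAt hlam (a := c) fun s hs => ?_
  exact (Summable.of_norm_bounded hc (norm_term_le hlam c hs)).hasSum.tendsto_sum_nat

theorem continuous_tsum_boundary {lam : ℕ → ℝ} {c : ℕ → ℂ} (hc : Summable fun n => ‖c n‖) :
    Continuous fun t : ℝ => ∑' n, c n * Complex.exp (-Complex.I * lam n * t) :=
  continuous_tsum (fun n => by fun_prop) hc fun n t => by
    rw [norm_mul, norm_exp_imag, mul_one]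

/-- A function on the line which is bounded and measurable has a Poisson integral. -/
theorem poissonConvExists_of_bound {u : ℝ} (hu : 0 < u) {g : ℝ → ℂ} {C : ℝ}
    (hg : AEStronglyMeasurable g) (hC : ∀ᵐ t, ‖g t‖ ≤ C) (t : ℝ) : PoissonConvExists u g t := by
  have hq : Measure.QuasiMeasurePreserving (fun y : ℝ => t - y) volume volume :=
    quasiMeasurePreserving_sub_left volume t
  have hP := integrable_poissonKernel hu
  change Integrable fun y => poissonKernel u y • g (t - y)
  refine Integrable.mono' (hP.const_mul C)
    (hP.aestronglyMeasurable.smul (hg.comp_quasiMeasurePreserving hq)) ?_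
  have h2 := hq.ae hC
  filter_upwards [h2] with y hy
  rw [norm_smul, Real.norm_of_nonneg (poissonKernel_nonneg hu y), mul_comm]
  exact mul_le_mul_of_nonneg_right hy (poissonKernel_nonneg hu y)

theorem norm_poissonConv_le {u : ℝ} (hu : 0 < u) {g : ℝ → ℂ} {C : ℝ} (hC : ∀ t, ‖g t‖ ≤ C)
    (t : ℝ) : ‖poissonConv u g t‖ ≤ C := by
  rw [poissonConv_eq_integral]
  have h := norm_integral_le_of_norm_le (f := fun y => poissonKernel u y • g (t - y))
    ((integrable_poissonKernel hu).const_mul C) (ae_of_all _ fun y => by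
      rw [norm_smul, Real.norm_of_nonneg (poissonKernel_nonneg hu y), mul_comm]
      exact mul_le_mul_of_nonneg_right (hC _) (poissonKernel_nonneg hu y))
  rwa [integral_const_mul, integral_poissonKernel hu, mul_one] at h

theorem tendsto_poissonConv {u : ℝ} (hu : 0 < u) {f : ℕ → ℝ → ℂ} {g : ℝ → ℂ} {C : ℝ}
    (hf : ∀ k, Continuous (f k)) (hC : ∀ k t, ‖f k t‖ ≤ C)
    (hlim : ∀ᵐ t, Tendsto (fun k => f k t) atTop (𝓝 (g t))) (t : ℝ) :
    Tendsto (fun k => poissonConv u (f k) t) atTop (𝓝 (poissonConv u g t)) := by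
  have hP := integrable_poissonKernel hu
  have hq : Measure.QuasiMeasurePreserving (fun y : ℝ => t - y) volume volume :=
    quasiMeasurePreserving_sub_left volume t
  simp only [poissonConv_eq_integral]
  refine tendsto_integral_of_dominated_convergence (fun y => C * poissonKernel u y)
    (fun k => hP.aestronglyMeasurable.smul
      ((hf k).comp (continuous_const.sub continuous_id)).aestronglyMeasurable)
    (hP.const_mul C) (fun k => ae_of_all _ fun y => ?_) ?_
  · rw [norm_smul, Real.norm_of_nonneg (poissonKernel_nonneg hu y), mul_comm]
    exact mul_le_mul_of_nonneg_right (hC _ _) (poissonKernel_nonneg hu y)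
  · have h2 := hq.ae hlim
    filter_upwards [h2] with y hy using hy.const_smul _

/-- If the Gaussian means of `∑ bₙ e^{-i lamₙ t}` are uniformly bounded and converge almost
everywhere to `g`, then `∑ bₙ e^{-lamₙ s}` converges on `[Re > 0]` to the Poisson integral
of `g`. -/
theorem hasValueAt_poissonConv {lam : ℕ → ℝ} (hlam : IsFrequency lam) (hL : L lam < ⊤)
    (hD : DInftyExt lam = DInfty lam) {b : ℕ → ℂ} {M : ℝ} (hb : ∀ n, ‖b n‖ ≤ M)
    {r : ℕ → ℝ} (hr0 : ∀ k, r k ≠ 0) (hr : Tendsto r atTop (𝓝 0)) {g : ℝ → ℂ} {C : ℝ}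
    (hC : ∀ k, ∀ t : ℝ, ‖∑' n, gaussCoeff lam b (r k) n * Complex.exp (-Complex.I * lam n * t)‖ ≤ C)
    (hlim : ∀ᵐ t : ℝ, Tendsto (fun k => ∑' n, gaussCoeff lam b (r k) n *
      Complex.exp (-Complex.I * lam n * t)) atTop (𝓝 (g t))) {x : ℝ} (hx : 0 < x) (t : ℝ) :
    PoissonConvExists x g t ∧
      HasValueAt lam b ((x : ℂ) + t * Complex.I) (poissonConv x g t) := by
  have hs : ∀ k, Summable fun n => ‖gaussCoeff lam b (r k) n‖ := fun k =>
    summable_gaussCoeff hlam hL hb (hr0 k)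
  have hcont := fun k => continuous_tsum_boundary (lam := lam) (hs k)
  have hgm : AEStronglyMeasurable g :=
    aestronglyMeasurable_of_tendsto_ae atTop (fun k => (hcont k).aestronglyMeasurable) hlim
  have hgC : ∀ᵐ t, ‖g t‖ ≤ C := by
    filter_upwards [hlim] with t ht
    exact le_of_tendsto ht.norm (Eventually.of_forall fun k => hC k t)
  refine ⟨poissonConvExists_of_bound hx hgm hgC t, ?_⟩
  set F : ℂ → ℂ := fun s => poissonConv s.re g s.im with hF
  set Fk : ℕ → ℂ → ℂ := fun k s => ∑' n, term lam (gaussCoeff lam b (r k)) s n with hFk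
  have hFk_eq : ∀ k, ∀ s : ℂ, 0 < s.re → poissonConv s.re (fun t : ℝ => ∑' n,
      gaussCoeff lam b (r k) n * Complex.exp (-Complex.I * lam n * t)) s.im = Fk k s := by
    intro k s hs'
    rw [poissonConv_tsum (hs k) hlam hs', Complex.re_add_im]
  have hFk_lim : ∀ s : ℂ, 0 < s.re → Tendsto (fun k => Fk k s) atTop (𝓝 (F s)) := by
    intro s hs'
    have := tendsto_poissonConv hs' hcont hC hlim s.im
    simpa only [hFk_eq _ s hs'] using this
  have hFk_le : ∀ k, ∀ s : ℂ, 0 < s.re → ‖Fk k s‖ ≤ C := fun k s hs' => by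
    rw [← hFk_eq k s hs']
    exact norm_poissonConv_le hs' (hC k) _
  have hFd : DifferentiableOn ℂ F {s : ℂ | 0 < s.re} := by
    refine differentiableOn_of_tendsto_of_locally_bounded isOpen_rightHalfPlane
      (fun k => differentiableOn_tsum_term (hs k) hlam) (fun z hz => ⟨C, ?_⟩) hFk_lim
    filter_upwards [isOpen_rightHalfPlane.mem_nhds hz] with s hs' k using hFk_le k s hs'
  have hFC : ∀ s : ℂ, 0 < s.re → ‖F s‖ ≤ C := fun s hs' =>
    le_of_tendsto (hFk_lim s hs').norm (Eventually.of_forall fun k => hFk_le k s hs')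
  obtain ⟨σ, hσ, hsum⟩ := exists_summable_exp hlam hL
  have hFval : ∀ s : ℂ, σ < s.re → HasValueAt lam b s (F s) := by
    intro s hs'
    have hle : ∀ n, ‖Complex.exp (-(lam n : ℂ) * s)‖ ≤ Real.exp (-lam n * σ) := fun n => by
      rw [norm_exp_neg_mul, Real.exp_le_exp]
      nlinarith [hlam.nonneg n]
    have h1 : Tendsto (fun k => Fk k s) atTop (𝓝 (∑' n, term lam b s n)) := by
      refine tendsto_tsum_of_dominated_convergence (hsum.mul_left M)
        (fun n => (tendsto_gaussCoeff lam b n hr).mul_const _)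
        (Eventually.of_forall fun k n => ?_)
      rw [term_eq, norm_mul]
      exact mul_le_mul ((norm_gaussCoeff_le _ _ _ _).trans (hb n)) (hle n) (norm_nonneg _)
        ((norm_nonneg _).trans (hb n))
    rw [tendsto_nhds_unique (hFk_lim s (hσ.trans hs')) h1]
    have h2 : Summable fun n => term lam b s n := by
      refine Summable.of_norm_bounded (hsum.mul_left M) fun n => ?_
      rw [term_eq, norm_mul]
      exact mul_le_mul (hb n) (hle n) (norm_nonneg _) ((norm_nonneg _).trans (hb n))
    exact h2.hasSum.tendsto_sum_nat
  -- The equality of the two spaces enters here. It yields convergence to some function `F'` only;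
  -- the identity theorem then shows `F' = F`.
  have hmem : b ∈ DInfty lam := hD ▸ ⟨F, hFd, ⟨C, hFC⟩, σ, hσ.le, hFval⟩
  obtain ⟨F', hF', -⟩ := hmem
  have hF'd := differentiableOn_of_hasValueAt hlam hF'
  have hEq : Set.EqOn F' F {s : ℂ | 0 < s.re} := by
    refine AnalyticOnNhd.eqOn_of_preconnected_of_eventuallyEq
      (hF'd.analyticOnNhd isOpen_rightHalfPlane) (hFd.analyticOnNhd isOpen_rightHalfPlane)
      (convex_halfSpace_re_gt 0).isPreconnected (z₀ := ((σ + 1 : ℝ) : ℂ)) ?_ ?_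
    · change 0 < ((σ + 1 : ℝ) : ℂ).re
      rw [Complex.ofReal_re]; positivity
    · have hopen : IsOpen {s : ℂ | σ < s.re} := isOpen_lt continuous_const Complex.continuous_re
      filter_upwards [hopen.mem_nhds (show σ < ((σ + 1 : ℝ) : ℂ).re by
        rw [Complex.ofReal_re]; linarith)] with s hs'
      exact tendsto_nhds_unique (hF' s (hσ.trans hs')) (hFval s hs')
  have hxt : (0 : ℝ) < ((x : ℂ) + t * Complex.I).re := by simpa using hx
  have h1 := hF' _ hxt
  rw [hEq hxt, hF] at h1
  simpa using h1

section Groups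

variable {G : Type u} [CommGroup G] [TopologicalSpace G] [IsTopologicalGroup G] [CompactSpace G]
  [T2Space G] [MeasurableSpace G] [BorelSpace G]

/-- Almost every vertical limit of a series in `𝓗_∞(lam)` converges on `[Re > 0]` to the Poisson
integral of the corresponding orbit. -/
theorem ae_hasValueAt_verticalLimit {lam : ℕ → ℝ} (hlam : IsFrequency lam) (hL : L lam < ⊤)
    (hD : DInftyExt lam = DInfty lam) {β : Multiplicative ℝ →ₜ* G}
    (hβ : IsDirichletGroup lam β) {f : G → ℂ} (hf : MemHardy hβ ∞ f) :
    ∀ᵐ ω ∂(haar G), ∀ x t : ℝ, 0 < x → PoissonConvExists x (orbit β f ω) t ∧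
      HasValueAt lam (verticalLimit hβ (bohrMap hβ f) ω) ((x : ℂ) + (t : ℂ) * Complex.I)
        (poissonConv x (orbit β f ω) t) := by
  set a := bohrMap hβ f
  have hfs := hf.hasFourierSeries
  obtain ⟨C, hC⟩ := hf.exists_aeBounded
  have hs : ∀ r ≠ 0, Summable fun n => ‖gaussCoeff lam a r n‖ := fun r hr =>
    summable_gaussCoeff hlam hL hfs.norm_le hr
  obtain ⟨r, hr0, hr, hlim⟩ := hfs.exists_tendsto_ae hlam hs
  have hlim' : ∀ᵐ ω ∂(haar G), Tendsto (fun k => gaussSum hβ a (r k) ω) atTop (𝓝 (f ω)) := by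
    filter_upwards [hlim, hf.memLp_two.coeFn_toLp] with ω h1 h2
    rwa [← h2]
  -- The exceptional set of `ω` is fixed before `x` and `t`, so one null set serves the whole half
  -- plane.
  filter_upwards [ae_ae_orbit (β := β) hlim'] with ω hω x t hx
  have hsum : ∀ k, ∀ t : ℝ, ∑' n, gaussCoeff lam (verticalLimit hβ a ω) (r k) n *
      Complex.exp (-Complex.I * lam n * t)
        = gaussSum hβ a (r k) (ω * β (Multiplicative.ofAdd t)) := fun k t => by
    rw [← (hasSum_gaussSum_apply hβ (hs _ (hr0 k)) _).tsum_eq]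
    congr 1 with n
    rw [map_mul, Circle.coe_mul, hβ.char_apply, gaussCoeff, gaussCoeff, verticalLimit]
    ring
  refine hasValueAt_poissonConv hlam hL hD
    (M := ‖hf.memLp_two.toLp‖) (fun n => ?_) hr0 hr (C := C) (fun k t => ?_) ?_ hx t
  · rw [verticalLimit, norm_mul, Circle.norm_coe, mul_one]
    exact hfs.norm_le n
  · rw [hsum]
    exact hfs.norm_gaussSum_le hlam hC (hs _ (hr0 k)) _
  · simp only [hsum]
    exact hω

end Groups
end GeneralDirichlet

end

theorem mainTheorem9
    (lam : ℕ → ℝ) (hlam : GeneralDirichlet.IsFrequency lam)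
    (hL : GeneralDirichlet.L lam < ⊤)
    (hD : GeneralDirichlet.DInftyExt lam = GeneralDirichlet.DInfty lam)
    (a : ℕ → ℂ) (ha : a ∈ GeneralDirichlet.HardyDirichlet.{u} lam ∞)
    (G : Type v) [CommGroup G] [TopologicalSpace G] [IsTopologicalGroup G]
    [CompactSpace G] [T2Space G] [MeasurableSpace G] [BorelSpace G]
    (β : Multiplicative ℝ →ₜ* G) (hβ : GeneralDirichlet.IsDirichletGroup lam β) :
    (∀ᵐ ω ∂(GeneralDirichlet.haar G), ∀ s : ℂ, 0 < s.re →
      GeneralDirichlet.ConvergesAt lam (GeneralDirichlet.verticalLimit hβ a ω) s) ∧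
    ∀ f : G → ℂ, GeneralDirichlet.MemHardy hβ ∞ f → GeneralDirichlet.bohrMap hβ f = a →
      ∀ᵐ ω ∂(GeneralDirichlet.haar G), ∀ x t : ℝ, 0 < x →
        GeneralDirichlet.PoissonConvExists x (GeneralDirichlet.orbit β f ω) t ∧
        GeneralDirichlet.HasValueAt lam (GeneralDirichlet.verticalLimit hβ a ω)
          ((x : ℂ) + (t : ℂ) * Complex.I)
          (GeneralDirichlet.poissonConv x (GeneralDirichlet.orbit β f ω) t) := by
  constructor
  -- Any function on `G` itself with these coefficients reduces the first claim to the second.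
  · obtain ⟨f, hf, rfl⟩ :=
      GeneralDirichlet.exists_memHardy_of_mem_hardyDirichlet hlam hL hβ ha
    filter_upwards [GeneralDirichlet.ae_hasValueAt_verticalLimit hlam hL hD hβ hf] with ω hω s hs
    have h := (hω s.re s.im hs).2
    rw [Complex.re_add_im] at h
    exact ⟨_, h⟩
  · rintro f hf rfl
    exact GeneralDirichlet.ae_hasValueAt_verticalLimit hlam hL hD hβ hf
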